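/- **Setting.** Let $\Omega\subset\mathbb{R}^d$ be open and bounded with smooth boundary and outward unit normal $\mathbf n$, let $k\in\mathbb N$ satisfy $2k>\frac d2+2$, and let $\gamma>1$. Let $V,\phi,\xi,h\in C^\infty(\overline\Omega)$ and $H\in C^\infty(\overline\Omega\times\mathbb{R}^d)$ with $\phi\ge 0$ in $\Omega$ and $\int_\Omega\phi\,dx=1$. Assume that for some constants $C>0$ and all $(x,p)\in\Omega\times\mathbb{R}^d$, $$-H(x,p)+D_pH(x,p)\cdot p\ge \tfrac1C|p|^\gamma-C,\qquad H(x,p)\ge\tfrac1C|p|^\gamma-C,\qquad |D_pH(x,p)|\le C|p|^{\gamma-1}+C .$$ Let $g\in C^\infty([0,\infty))$ be increasing, and suppose that for every $\delta>0$ there is a constant $C_\delta>0$ such that for all $f\in L^1(\Omega)$ with $f\ge0$, $$\max\Big\{\int_\Omega|g(f)|\,dx,\int_\Omega f\,dx\Big\}\le\delta\int_\Omega f g(f)\,dx+C_\delta .$$ For $\epsilon\in(0,1)$ consider the regularized problem for $(m,u)$ with $m\ge0$: $$\begin{cases}-u-H(x,Du)+g(m)-V+\epsilon(m+\Delta^{2k}m)=0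 & \text{in }\Omega,\\ m-\operatorname{div}(mD_pH(x,Du))-\phi+\epsilon\big(u+\xi+\Delta^{2k}(u+\xi)\big)=0 & \text{in }\Omega,\\ \frac{\partial}{\partial\mathbf n}\partial^\alpha\Delta^i m=0 \text{ on }\partial\Omega & \text{for all } |\alpha|+i=2k-1,\\ \partial^\beta u=\partial^\beta h\text{ on }\partial\Omega & \text{for all } |\beta|\le 2k-1.\end{cases}$$ A *classical solution* is a pair $(m,u)\in C^{4k}(\overline\Omega)\times C^{4k}(\overline\Omega)$ with $m\ge0$ satisfying these relations pointwise. A *weak solution* is a pair $(m,u)\in H^{2k}(\Omega)\times H^{2k}(\Omega)$ with $m\ge 0$ and $u-h\in H^{2k}_0(\Omega)$ such that, for all $w\in H^{2k}(\Omega)$ with $w\ge0$ and all $v\in H_0^{2k}(\Omega)$, $$\int_\Omega(-u-H(x,Du)+g(m)-V)(w-m)\,dx+\int_\Omega\Big[\epsilon m(w-m)+\epsilon\sum_{|\alpha|=2k}\partial^\alpha m(\partial^\alpha w-\partial^\alpha m)\Big]dx\ge0,$$ $$\int_\Omega\big(m-\operatorname{div}(mD_pH(x,Du))-\phi\big)v\,dx+\int_\Omega\Big[\epsilon\Big(uv+\sum_{|\alpha|=2k}\partial^\alpha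 u\,\partial^\alpha v\Big)+\epsilon(\xi+\Delta^{2k}\xi)v\Big]dx=0 .$$ **Statement.** There is a constant $C>0$, depending only on $\Omega,d,k,\gamma,H,V,\phi,\xi,h$, the constants in the three growth conditions on $H$ and the constants $(C_\delta)_{\delta>0}$ (in particular independent of $\epsilon\in(0,1)$, of the solution and, given $(C_\delta)_{\delta>0}$, of $g$), such that every classical solution and every weak solution $(m,u)$ of the regularized problem satisfies $$\int_\Omega\Big(mg(m)+\tfrac1Cm|Du|^\gamma+\tfrac1C\phi|Du|^\gamma\Big)dx+\epsilon\int_\Omega\Big[m^2+u^2+\sum_{|\alpha|=2k}\big((\partial^\alpha m)^2+(\partial^\alpha u)^2\big)\Big]dx\le C,$$ all these integrals being convergent. -/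

import Mathlib

open MeasureTheory Set
open scoped ContDiff ENNReal

namespace MFG

noncomputable section

/-- The Euclidean space `ℝ^d`. -/
abbrev Rd (d : ℕ) : Type := EuclideanSpace ℝ (Fin d)

/-! ### Domains with smooth boundary -/

/-- `ρ` is a smooth defining function of the open set `Ω`: `Ω = {ρ < 0}`, and the gradient of `ρ`
does not vanish on `{ρ = 0}` (which is then the boundary of `Ω`). -/
def IsDefiningFunction {d : ℕ} (Ω : Set (Rd d)) (ρ : Rd d → ℝ) : Prop :=
  ContDiff ℝ ∞ ρ ∧ Ω = {x | ρ x < 0} ∧ ∀ x, ρ x = 0 → gradient ρ x ≠ 0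

/-- `Ω` is an open set with smooth boundary (and lies locally on one side of it). -/
def HasSmoothBoundary {d : ℕ} (Ω : Set (Rd d)) : Prop :=
  ∃ ρ, IsDefiningFunction Ω ρ

/-- `ν` is the outward pointing unit normal to `Ω` at the boundary point `x`. -/
def IsOutwardNormal {d : ℕ} (Ω : Set (Rd d)) (x ν : Rd d) : Prop :=
  x ∈ frontier Ω ∧ ∃ ρ, IsDefiningFunction Ω ρ ∧ ν = ‖gradient ρ x‖⁻¹ • gradient ρ x

/-! ### Classical partial derivatives

All classical derivatives are taken within a set `S`. With `S = univ` they are the usual ones;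
with `S = closure Ω` they are the usual ones in `Ω` and, for functions that are smooth up to the
boundary, their continuous extensions on the boundary. -/

/-- The partial derivative `∂ᵢ f`. -/
def pd {d : ℕ} (S : Set (Rd d)) (i : Fin d) (f : Rd d → ℝ) : Rd d → ℝ :=
  fun x => fderivWithin ℝ f S x (EuclideanSpace.single i 1)

/-- The partial derivative `∂^α f = ∂₁^{α₁} ⋯ ∂_d^{α_d} f` for a multi-index `α`. -/
def mpd {d : ℕ} (S : Set (Rd d)) (α : Fin d → ℕ) (f : Rd d → ℝ) : Rd d → ℝ :=
  (List.finRange d).foldr (fun i F => (pd S i)^[α i] F) f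

/-- The iterated Laplacian `Δ^n f`. -/
def lapPow {d : ℕ} (S : Set (Rd d)) (n : ℕ) (f : Rd d → ℝ) : Rd d → ℝ :=
  (fun F => InnerProductSpace.laplacianWithin F S)^[n] f

/-- The finite set of multi-indices `α` with `|α| = n`. -/
def multiIndices (d n : ℕ) : Finset (Fin d → ℕ) :=
  Finset.piAntidiag Finset.univ n

/-- The gradient of `f` formed with a given derivative operator `D` (so `D α f` stands for
`∂^α f`, classical or weak). -/
def gradOf {d : ℕ} (D : (Fin d → ℕ) → (Rd d → ℝ) → Rd d → ℝ) (f : Rd d → ℝ) (x : Rd d) : Rd d :=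
  WithLp.toLp 2 (fun i => D (Pi.single i 1) f x)

/-! ### Weak derivatives and Sobolev spaces -/

/-- Test functions: `η ∈ C_c^∞(Ω)`. -/
def IsTest {d : ℕ} (Ω : Set (Rd d)) (η : Rd d → ℝ) : Prop :=
  ContDiff ℝ ∞ η ∧ HasCompactSupport η ∧ tsupport η ⊆ Ω

/-- `f'` is the weak derivative `∂^α f` in `Ω`. -/
def IsWeakDeriv {d : ℕ} (Ω : Set (Rd d)) (α : Fin d → ℕ) (f f' : Rd d → ℝ) : Prop :=
  LocallyIntegrableOn f Ω ∧ LocallyIntegrableOn f' Ω ∧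
    ∀ η, IsTest Ω η →
      ∫ x in Ω, f x * mpd univ α η x = (-1) ^ (∑ i, α i) * ∫ x in Ω, f' x * η x

open Classical in
/-- The weak derivative `∂^α f` in `Ω` (determined almost everywhere in `Ω` when it exists). -/
def weakDeriv {d : ℕ} (Ω : Set (Rd d)) (α : Fin d → ℕ) (f : Rd d → ℝ) : Rd d → ℝ :=
  if hf : ∃ f', IsWeakDeriv Ω α f f' then hf.choose else 0

/-- `f ∈ H^n(Ω)`. -/
def MemH {d : ℕ} (Ω : Set (Rd d)) (n : ℕ) (f : Rd d → ℝ) : Prop :=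
  MemLp f 2 (volume.restrict Ω) ∧
    ∀ α : Fin d → ℕ, ∑ i, α i ≤ n →
      ∃ f', IsWeakDeriv Ω α f f' ∧ MemLp f' 2 (volume.restrict Ω)

/-- `f ∈ H_0^n(Ω)`, the closure of `C_c^∞(Ω)` in `H^n(Ω)`. -/
def MemH0 {d : ℕ} (Ω : Set (Rd d)) (n : ℕ) (f : Rd d → ℝ) : Prop :=
  MemH Ω n f ∧
    ∀ δ : ℝ≥0∞, 0 < δ → ∃ η, IsTest Ω η ∧
      ∀ α : Fin d → ℕ, ∑ i, α i ≤ n →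
        eLpNorm (fun x => weakDeriv Ω α f x - mpd univ α η x) 2 (volume.restrict Ω) < δ

/-- `D` is the weak divergence of the vector field `F` in `Ω`. -/
def IsWeakDiv {d : ℕ} (Ω : Set (Rd d)) (F : Rd d → Rd d) (D : Rd d → ℝ) : Prop :=
  LocallyIntegrableOn F Ω ∧ LocallyIntegrableOn D Ω ∧
    ∀ η, IsTest Ω η →
      ∫ x in Ω, ∑ i, F x i * pd univ i η x = - ∫ x in Ω, D x * η x

/-! ### The regularized mean-field game -/

/-- The domain, the Hamiltonian and the functions `V, φ, ξ, h` of the regularized problem, with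
their standing assumptions. Only their values on `closure Ω` matter. -/
structure ProblemData (d : ℕ) where
  Ω : Set (Rd d)
  H : Rd d → Rd d → ℝ
  V : Rd d → ℝ
  φ : Rd d → ℝ
  ξ : Rd d → ℝ
  h : Rd d → ℝ
  bounded : Bornology.IsBounded Ω
  smoothBoundary : HasSmoothBoundary Ω
  H_smooth : ContDiffOn ℝ ∞ (fun z : Rd d × Rd d => H z.1 z.2) (closure Ω ×ˢ univ)
  V_smooth : ContDiffOn ℝ ∞ V (closure Ω)
  φ_smooth : ContDiffOn ℝ ∞ φ (closure Ω)
  ξ_smooth : ContDiffOn ℝ ∞ ξ (closure Ω)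
  h_smooth : ContDiffOn ℝ ∞ h (closure Ω)
  φ_nonneg : ∀ x ∈ Ω, 0 ≤ φ x
  φ_integral : ∫ x in Ω, φ x = 1

namespace ProblemData

variable {d : ℕ} (P : ProblemData d)

/-- `D_p H(x, p)`, the gradient of `H` in its second variable. -/
def DpH (x p : Rd d) : Rd d := gradient (P.H x) p

/-- `-H(x,p) + D_pH(x,p)·p ≥ |p|^γ / C - C`. -/
def Coercive (γ : ℝ) : Prop :=
  ∃ C > 0, ∀ x ∈ P.Ω, ∀ p : Rd d,
    1 / C * ‖p‖ ^ γ - C ≤ -P.H x p + inner ℝ (P.DpH x p) p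

/-- `H(x,p) ≥ |p|^γ / C - C`. -/
def LowerGrowth (γ : ℝ) : Prop :=
  ∃ C > 0, ∀ x ∈ P.Ω, ∀ p : Rd d, 1 / C * ‖p‖ ^ γ - C ≤ P.H x p

/-- `|D_pH(x,p)| ≤ C |p|^(γ-1) + C`. -/
def GradientGrowth (γ : ℝ) : Prop :=
  ∃ C > 0, ∀ x ∈ P.Ω, ∀ p : Rd d, ‖P.DpH x p‖ ≤ C * ‖p‖ ^ (γ - 1) + C

/-- `g` is increasing on `[0, ∞)` and, for all `δ > 0` and all nonnegative `f ∈ L¹(Ω)`,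
`max {∫ |g(f)|, ∫ f} ≤ δ ∫ f g(f) + C_δ`. As `g` is bounded from below by `g 0`, the integral
`∫ f g(f)` is either convergent or `+∞`; in the second case there is nothing to require. -/
def CouplingGrowth (g : ℝ → ℝ) (Cδ : ℝ → ℝ) : Prop :=
  MonotoneOn g (Ici 0) ∧
    ∀ δ > 0, 0 < Cδ δ ∧ ∀ f : Rd d → ℝ, IntegrableOn f P.Ω →
      (∀ᵐ x ∂volume.restrict P.Ω, 0 ≤ f x) →
      IntegrableOn (fun x => f x * g (f x)) P.Ω →
      max (∫ x in P.Ω, |g (f x)|) (∫ x in P.Ω, f x) ≤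
        δ * (∫ x in P.Ω, f x * g (f x)) + Cδ δ

/-- `(m, u)` is a classical solution of the regularized problem: both functions belong to
`C^{4k}(closure Ω)`, `m ≥ 0`, the two equations hold pointwise in `Ω`, and the boundary conditions
hold pointwise on the boundary. -/
structure IsClassicalSolution (k : ℕ) (g : ℝ → ℝ) (ε : ℝ) (m u : Rd d → ℝ) : Prop where
  m_smooth : ContDiffOn ℝ ((4 * k : ℕ) : ℕ∞) m (closure P.Ω)
  u_smooth : ContDiffOn ℝ ((4 * k : ℕ) : ℕ∞) u (closure P.Ω)
  m_nonneg : ∀ x ∈ P.Ω, 0 ≤ m x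
  hamiltonJacobi : ∀ x ∈ P.Ω,
    -u x - P.H x (gradOf (mpd (closure P.Ω)) u x) + g (m x) - P.V x
      + ε * (m x + lapPow (closure P.Ω) (2 * k) m x) = 0
  transport : ∀ x ∈ P.Ω,
    m x - (∑ i, pd (closure P.Ω) i
        (fun y => m y * P.DpH y (gradOf (mpd (closure P.Ω)) u y) i) x) - P.φ x
      + ε * (u x + P.ξ x + lapPow (closure P.Ω) (2 * k) (fun y => u y + P.ξ y) x) = 0
  boundary_m : ∀ (α : Fin d → ℕ) (j : ℕ), (∑ i, α i) + j + 1 = 2 * k →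
    ∀ x ∈ frontier P.Ω, ∀ ν, IsOutwardNormal P.Ω x ν →
      fderivWithin ℝ (mpd (closure P.Ω) α (lapPow (closure P.Ω) j m)) (closure P.Ω) x ν = 0
  boundary_u : ∀ β : Fin d → ℕ, ∑ i, β i + 1 ≤ 2 * k →
    ∀ x ∈ frontier P.Ω, mpd (closure P.Ω) β u x = mpd (closure P.Ω) β P.h x

/-- `(m, u)` is a weak solution of the regularized problem. All derivatives of `m, u, v, w` are weak
derivatives in `Ω`. The variational inequality includes that its first integral converges, and the
divergence in the weak equation is the weak divergence, as a function in `L²(Ω)`; both are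
automatic by the Sobolev embedding `H^{2k}(Ω) ⊂ C²(closure Ω)`, valid for `2k > d/2 + 2`. -/
structure IsWeakSolution (k : ℕ) (g : ℝ → ℝ) (ε : ℝ) (m u : Rd d → ℝ) : Prop where
  m_mem : MemH P.Ω (2 * k) m
  u_mem : MemH P.Ω (2 * k) u
  u_boundary : MemH0 P.Ω (2 * k) (fun x => u x - P.h x)
  m_nonneg : ∀ᵐ x ∂volume.restrict P.Ω, 0 ≤ m x
  variational : ∀ w, MemH P.Ω (2 * k) w → (∀ᵐ x ∂volume.restrict P.Ω, 0 ≤ w x) →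
    IntegrableOn (fun x =>
      (-u x - P.H x (gradOf (weakDeriv P.Ω) u x) + g (m x) - P.V x) * (w x - m x)) P.Ω ∧
    0 ≤ (∫ x in P.Ω,
          (-u x - P.H x (gradOf (weakDeriv P.Ω) u x) + g (m x) - P.V x) * (w x - m x))
      + ∫ x in P.Ω, (ε * m x * (w x - m x)
          + ε * ∑ α ∈ multiIndices d (2 * k), weakDeriv P.Ω α m x *
              (weakDeriv P.Ω α w x - weakDeriv P.Ω α m x))
  transport : ∃ D : Rd d → ℝ, MemLp D 2 (volume.restrict P.Ω) ∧
    IsWeakDiv P.Ω (fun x => m x • P.DpH x (gradOf (weakDeriv P.Ω) u x)) D ∧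
    ∀ v, MemH0 P.Ω (2 * k) v →
      (∫ x in P.Ω, (m x - D x - P.φ x) * v x)
        + (∫ x in P.Ω, (ε * (u x * v x
              + ∑ α ∈ multiIndices d (2 * k), weakDeriv P.Ω α u x * weakDeriv P.Ω α v x)
            + ε * (P.ξ x + lapPow (closure P.Ω) (2 * k) P.ξ x) * v x)) = 0

/-- The a priori estimate with constant `C`, where `D α f` stands for `∂^α f`: the integrals
converge and
`∫ (m g(m) + m|Du|^γ/C + φ|Du|^γ/C) + ε ∫ (m² + u² + Σ_{|α|=2k} ((∂^α m)² + (∂^α u)²)) ≤ C`. -/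
def AprioriEstimate (γ : ℝ) (k : ℕ) (g : ℝ → ℝ) (ε C : ℝ)
    (D : (Fin d → ℕ) → (Rd d → ℝ) → Rd d → ℝ) (m u : Rd d → ℝ) : Prop :=
  IntegrableOn (fun x => m x * g (m x)) P.Ω ∧
  IntegrableOn (fun x => m x * ‖gradOf D u x‖ ^ γ) P.Ω ∧
  IntegrableOn (fun x => P.φ x * ‖gradOf D u x‖ ^ γ) P.Ω ∧
  IntegrableOn (fun x => m x ^ 2 + u x ^ 2
    + ∑ α ∈ multiIndices d (2 * k), (D α m x ^ 2 + D α u x ^ 2)) P.Ω ∧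
  (∫ x in P.Ω, (m x * g (m x) + 1 / C * (m x * ‖gradOf D u x‖ ^ γ)
      + 1 / C * (P.φ x * ‖gradOf D u x‖ ^ γ)))
    + ε * (∫ x in P.Ω, (m x ^ 2 + u x ^ 2
      + ∑ α ∈ multiIndices d (2 * k), (D α m x ^ 2 + D α u x ^ 2))) ≤ C

end ProblemData

end

end MFG

namespace MFG

open Filter Topology

/-! The estimate is the energy identity of the mean-field game, obtained by comparing the solution
with the pair of data `(φ, h)`. Multiply the Hamilton-Jacobi equation by `m - φ`, the transport
equation by `u - h`, add and integrate by parts. The products of `u` with `m - φ` cancel, and what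
is left is the integral of `energyDensity`. It is zero for a classical solution. For a weak solution
it is at most zero, because `w = φ` is admissible in the variational inequality and `v = u - h` in
the weak equation.

Pointwise, `energyDensity` is bounded below (`exists_energyDensity_lower_bound`). Coercivity gives
`m|Du|^γ`, the lower growth of `H` gives `φ|Du|^γ`, the cross term `m D_pH·Dh` is absorbed by
Young's inequality, and the `ε`-terms are quadratic forms minus squares of data. The only
uncontrolled terms are `K m` and `K |g(m)|`. The growth condition on the coupling, with `δ =
1/(4K)`, absorbs them into half of `∫ m g(m)` (`exists_energy_bound`). The constants come from the
data and from `Cδ`, and `ε` enters through `ε < 1` alone. The index set of the top-order derivatives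
is left arbitrary, so that both kinds of solutions use the same bound.

The analytic work is to justify the integral relation.

For classical solutions one needs Green's formula for `Δ^{2k}` without boundary terms
(`IsDefiningFunction.integral_lapPow_mul`). It rests on the divergence theorem for fields tangential
at the boundary (`IsDefiningFunction.integral_div_eq_zero`), for which cutoffs built from a defining
function suffice. The formula produces a sum over ordered words of directions, which dominates the
sum over multi-indices.

For weak solutions one needs `Du` to be bounded, so that `m D_pH(x, Du)` is in `L²` and all
integrals converge. This is a Sobolev bound for test functions, proved by Fourier transform
(`exists_schwartz_sobolev_bound`) and carried over to `u - h ∈ H_0^{2k}` by approximation. -/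

/-- Sets on which iterated derivatives within the set are well behaved. -/
structure IsRegularSet {d : ℕ} (S : Set (Rd d)) : Prop where
  uniqueDiffOn : UniqueDiffOn ℝ S
  subset_closure_interior : S ⊆ closure (interior S)

lemma isRegularSet_univ {d : ℕ} : IsRegularSet (univ : Set (Rd d)) :=
  ⟨uniqueDiffOn_univ, by simp⟩

/-- The iterated partial derivative along a list of directions. -/
noncomputable def pdl {d : ℕ} (S : Set (Rd d)) (L : List (Fin d)) (f : Rd d → ℝ) : Rd d → ℝ :=
  L.foldr (pd S) f

/-! ### Iterated partial derivatives within a set -/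

section Calculus

variable {d : ℕ} {S : Set (Rd d)} {f g : Rd d → ℝ} {n : ℕ} {i j : Fin d}

@[simp] lemma pdl_nil : pdl S [] f = f := rfl

@[simp] lemma pdl_cons (L : List (Fin d)) : pdl S (i :: L) f = pd S i (pdl S L f) := rfl

lemma pdl_append (L M : List (Fin d)) : pdl S (L ++ M) f = pdl S L (pdl S M f) := by
  simp [pdl, List.foldr_append]

lemma contDiffOn_of_nat_le {m : ℕ} (h : m ≤ n) (hf : ContDiffOn ℝ n f S) : ContDiffOn ℝ m f S :=
  hf.of_le (by exact_mod_cast h)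

lemma pd_congr (h : EqOn f g S) : EqOn (pd S i f) (pd S i g) S := fun x hx => by
  simp only [pd, fderivWithin_congr h (h hx)]

lemma pdl_congr (h : EqOn f g S) (L : List (Fin d)) : EqOn (pdl S L f) (pdl S L g) S := by
  induction L with
  | nil => exact h
  | cons i L ih => exact pd_congr ih

lemma contDiffOn_pd (hS : IsRegularSet S) (hf : ContDiffOn ℝ (n + 1 : ℕ) f S) :
    ContDiffOn ℝ n (pd S i f) S :=
  (hf.fderivWithin hS.uniqueDiffOn (by simp)).clm_apply contDiffOn_const

lemma contDiffOn_pdl (hS : IsRegularSet S) (L : List (Fin d)) :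
    ∀ {n : ℕ}, ContDiffOn ℝ (n + L.length : ℕ) f S → ContDiffOn ℝ n (pdl S L f) S := by
  induction L with
  | nil => intro n h; simpa using h
  | cons i L ih =>
    intro n h
    exact contDiffOn_pd hS (ih (contDiffOn_of_nat_le (by rw [List.length_cons]; omega) h))

lemma contDiffOn_infty_pd (hS : IsRegularSet S) (hf : ContDiffOn ℝ ∞ f S) :
    ContDiffOn ℝ ∞ (pd S i f) S :=
  (hf.fderivWithin hS.uniqueDiffOn (by simp)).clm_apply contDiffOn_const

lemma contDiffOn_infty_pdl (hS : IsRegularSet S) (hf : ContDiffOn ℝ ∞ f S) (L : List (Fin d)) :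
    ContDiffOn ℝ ∞ (pdl S L f) S := by
  induction L with
  | nil => exact hf
  | cons i L ih => exact contDiffOn_infty_pd hS ih

lemma differentiableOn_of_contDiffOn_succ (hf : ContDiffOn ℝ (n + 1 : ℕ) f S) :
    DifferentiableOn ℝ f S := hf.differentiableOn (by norm_cast)

lemma pd_pd_apply (hS : IsRegularSet S) (hf : ContDiffOn ℝ 2 f S) {x : Rd d} (hx : x ∈ S) :
    pd S i (pd S j f) x = fderivWithin ℝ (fderivWithin ℝ f S) S x (EuclideanSpace.single i 1)
      (EuclideanSpace.single j 1) := by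
  have h1 : DifferentiableWithinAt ℝ (fderivWithin ℝ f S) S x :=
    (hf.fderivWithin (m := 1) hS.uniqueDiffOn (by norm_num)).differentiableOn (by norm_num) x hx
  have := fderivWithin_clm_apply (hS.uniqueDiffOn x hx) h1
    (differentiableWithinAt_const (EuclideanSpace.single j (1 : ℝ)))
  unfold pd
  rw [this]
  simp

/-- Symmetry of the second derivative within `S` also holds at boundary points because they are
limits of interior points; this is the role of `subset_closure_interior`. -/
lemma pd_comm (hS : IsRegularSet S) (hf : ContDiffOn ℝ 2 f S) :
    EqOn (pd S i (pd S j f)) (pd S j (pd S i f)) S := fun x hx => by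
  rw [pd_pd_apply hS hf hx, pd_pd_apply hS hf hx]
  exact (hf x hx).isSymmSndFDerivWithinAt (by simp) hS.uniqueDiffOn
    (hS.subset_closure_interior hx) hx _ _

lemma pdl_perm (hS : IsRegularSet S) {L M : List (Fin d)} (h : L.Perm M)
    (hf : ContDiffOn ℝ L.length f S) : EqOn (pdl S L f) (pdl S M f) S := by
  induction h with
  | nil => exact fun _ _ => rfl
  | cons i _ ih => exact pd_congr (ih (hf.of_le (by simp)))
  | swap i j L =>
    refine pd_comm hS ?_
    exact contDiffOn_pdl (n := 2) hS L (by simpa [add_assoc, add_comm, add_left_comm] using hf)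
  | trans h₁ _ ih₁ ih₂ => exact (ih₁ hf).trans (ih₂ (by rwa [← h₁.length_eq]))

lemma pd_sub (hS : IsRegularSet S) (hf : DifferentiableOn ℝ f S) (hg : DifferentiableOn ℝ g S) :
    EqOn (pd S i (fun x => f x - g x)) (fun x => pd S i f x - pd S i g x) S := fun x hx => by
  simp only [pd]
  rw [fderivWithin_fun_sub (hS.uniqueDiffOn x hx) (hf x hx) (hg x hx)]
  rfl

lemma pd_mul (hS : IsRegularSet S) (hf : DifferentiableOn ℝ f S) (hg : DifferentiableOn ℝ g S) :
    EqOn (pd S i (fun x => f x * g x)) (fun x => f x * pd S i g x + pd S i f x * g x) S :=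
  fun x hx => by
  simp only [pd]
  rw [fderivWithin_fun_mul (hS.uniqueDiffOn x hx) (hf x hx) (hg x hx)]
  simp [mul_comm]

lemma pd_sum (hS : IsRegularSet S) {ι : Type*} (s : Finset ι) {F : ι → Rd d → ℝ}
    (hF : ∀ a ∈ s, DifferentiableOn ℝ (F a) S) :
    EqOn (pd S i (fun x => ∑ a ∈ s, F a x)) (fun x => ∑ a ∈ s, pd S i (F a) x) S := fun x hx => by
  simp only [pd]
  rw [fderivWithin_fun_sum (hS.uniqueDiffOn x hx) (fun a ha => hF a ha x hx)]
  simp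

lemma pdl_sub (hS : IsRegularSet S) (L : List (Fin d))
    (hf : ContDiffOn ℝ L.length f S) (hg : ContDiffOn ℝ L.length g S) :
    EqOn (pdl S L (fun x => f x - g x)) (fun x => pdl S L f x - pdl S L g x) S := by
  induction L with
  | nil => exact fun _ _ => rfl
  | cons i L ih =>
    refine (pd_congr (ih (hf.of_le (by simp)) (hg.of_le (by simp)))).trans ?_
    have aux : ∀ {w : Rd d → ℝ}, ContDiffOn ℝ (i :: L).length w S →
        DifferentiableOn ℝ (pdl S L w) S := fun hw =>
      differentiableOn_of_contDiffOn_succ (n := 0)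
        (contDiffOn_pdl hS L (by simpa [add_comm] using hw))
    exact pd_sub hS (aux hf) (aux hg)

/-- The list of directions, in increasing order, in which `i` occurs `α i` times. -/
def wordOf (α : Fin d → ℕ) : List (Fin d) :=
  (List.finRange d).flatMap (fun i => List.replicate (α i) i)

/-- Lists of directions support induction and concatenation, which multi-indices do not; `mpd` is
handled through this identity from here on. -/
lemma mpd_eq_pdl (α : Fin d → ℕ) : mpd S α f = pdl S (wordOf α) f := by
  have h : ∀ (n : ℕ) (i : Fin d) (F : Rd d → ℝ),
      (pd S i)^[n] F = pdl S (List.replicate n i) F := by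
    intro n i F
    induction n with
    | zero => rfl
    | succ n ih => rw [Function.iterate_succ_apply', ih, List.replicate_succ, pdl_cons]
  unfold mpd wordOf
  induction List.finRange d with
  | nil => rfl
  | cons i l ih => rw [List.foldr_cons, ih, List.flatMap_cons, pdl_append, h]

lemma count_wordOf (α : Fin d → ℕ) (i : Fin d) : (wordOf α).count i = α i := by
  unfold wordOf
  rw [List.count_flatMap]
  have : (List.count i ∘ fun j => List.replicate (α j) j) = fun j => if j = i then α i else 0 := by
    ext j
    by_cases h : j = i
    · subst h; simp
    · simp [List.count_replicate, h]
  rw [this, ← List.ofFn_id, List.map_ofFn, List.sum_ofFn]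
  simp

lemma length_wordOf (α : Fin d → ℕ) : (wordOf α).length = ∑ i, α i := by
  rw [← Finset.sum_congr rfl fun i _ => count_wordOf α i]
  simpa using (Multiset.sum_count_eq_card (s := Finset.univ)
    (m := (wordOf α : Multiset (Fin d))) (by simp)).symm

lemma wordOf_count_perm (L : List (Fin d)) : (wordOf fun i => L.count i).Perm L := by
  rw [List.perm_iff_count]
  intro i
  exact count_wordOf _ i

lemma wordOf_single (i : Fin d) : wordOf (Pi.single i 1) = [i] := by
  refine List.perm_singleton.1 (List.perm_iff_count.2 fun j => ?_)
  rw [count_wordOf, List.count_singleton]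
  by_cases h : j = i
  · subst h; simp
  · simp [h, Ne.symm h]

lemma mpd_single : mpd S (Pi.single i 1) f = pd S i f := by
  rw [mpd_eq_pdl, wordOf_single]; rfl

lemma wordOf_zero : wordOf (0 : Fin d → ℕ) = [] := by
  rw [← List.length_eq_zero_iff, length_wordOf]; simp

lemma mpd_zero : mpd S 0 f = f := by
  rw [mpd_eq_pdl, wordOf_zero]; rfl

lemma contDiffOn_infty_mpd (hS : IsRegularSet S) (hf : ContDiffOn ℝ ∞ f S) (α : Fin d → ℕ) :
    ContDiffOn ℝ ∞ (mpd S α f) S := by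
  rw [mpd_eq_pdl]; exact contDiffOn_infty_pdl hS hf _

lemma sum_count (L : List (Fin d)) : ∑ i, L.count i = L.length := by
  rw [← length_wordOf fun i => L.count i, (wordOf_count_perm L).length_eq]

lemma pdl_eqOn_mpd (hS : IsRegularSet S) (L : List (Fin d)) (hf : ContDiffOn ℝ L.length f S) :
    EqOn (pdl S L f) (mpd S (fun i => L.count i) f) S := by
  rw [mpd_eq_pdl]
  exact pdl_perm hS (wordOf_count_perm L).symm hf

/-! ### The Laplacian -/

lemma laplacianWithin_eqOn (hS : IsRegularSet S) (hf : ContDiffOn ℝ 2 f S) :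
    EqOn (InnerProductSpace.laplacianWithin f S) (fun x => ∑ i, pd S i (pd S i f) x) S :=
  fun x hx => by
  rw [InnerProductSpace.laplacianWithin_eq_iteratedFDerivWithin_orthonormalBasis f hS.uniqueDiffOn hx
    (EuclideanSpace.basisFun (Fin d) ℝ)]
  refine Finset.sum_congr rfl fun i _ => ?_
  rw [iteratedFDerivWithin_two_apply _ hS.uniqueDiffOn hx, pd_pd_apply hS hf hx]
  simp

lemma laplacianWithin_congr_set (hS : IsRegularSet S) (h : EqOn f g S) :
    EqOn (InnerProductSpace.laplacianWithin f S) (InnerProductSpace.laplacianWithin g S) S :=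
  fun x hx => by
  rw [InnerProductSpace.laplacianWithin_eq_iteratedFDerivWithin_orthonormalBasis f hS.uniqueDiffOn hx
    (EuclideanSpace.basisFun (Fin d) ℝ),
    InnerProductSpace.laplacianWithin_eq_iteratedFDerivWithin_orthonormalBasis g hS.uniqueDiffOn hx
    (EuclideanSpace.basisFun (Fin d) ℝ), iteratedFDerivWithin_congr h hx]

@[simp] lemma lapPow_zero : lapPow S 0 f = f := rfl

lemma lapPow_succ : lapPow S (n + 1) f = InnerProductSpace.laplacianWithin (lapPow S n f) S := by
  unfold lapPow
  rw [Function.iterate_succ_apply']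

lemma contDiffOn_laplacianWithin (hS : IsRegularSet S) (hf : ContDiffOn ℝ (n + 2 : ℕ) f S) :
    ContDiffOn ℝ n (InnerProductSpace.laplacianWithin f S) S := by
  refine ContDiffOn.congr ?_ (laplacianWithin_eqOn hS (hf.of_le (by norm_cast; omega)))
  exact ContDiffOn.sum fun i _ => contDiffOn_pd hS (contDiffOn_pd hS hf)

lemma contDiffOn_lapPow (hS : IsRegularSet S) (j : ℕ) :
    ∀ {n : ℕ}, ContDiffOn ℝ (n + 2 * j : ℕ) f S → ContDiffOn ℝ n (lapPow S j f) S := by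
  induction j with
  | zero => intro n h; simpa using h
  | succ j ih =>
    intro n h
    rw [lapPow_succ]
    exact contDiffOn_laplacianWithin hS (ih (contDiffOn_of_nat_le (by omega) h))

lemma pd_laplacianWithin (hS : IsRegularSet S) (hf : ContDiffOn ℝ 3 f S) :
    EqOn (pd S i (InnerProductSpace.laplacianWithin f S))
      (InnerProductSpace.laplacianWithin (pd S i f) S) S := by
  have hf' : ContDiffOn ℝ (2 + 1 : ℕ) f S := by simpa using hf
  refine (pd_congr (laplacianWithin_eqOn hS (hf.of_le (by norm_num)))).trans ?_
  refine EqOn.trans ?_ (laplacianWithin_eqOn hS (contDiffOn_pd hS hf')).symm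
  refine (pd_sum hS _ fun j _ => ?_).trans fun x hx => Finset.sum_congr rfl fun j _ => ?_
  · exact differentiableOn_of_contDiffOn_succ (n := 0) (contDiffOn_pd hS (contDiffOn_pd hS hf'))
  · rw [pd_comm hS (contDiffOn_pd hS hf') hx]
    exact pd_congr (pd_comm hS (hf.of_le (by norm_num))) hx

lemma pd_lapPow (hS : IsRegularSet S) (n : ℕ) (hf : ContDiffOn ℝ (2 * n + 1 : ℕ) f S) :
    EqOn (pd S i (lapPow S n f)) (lapPow S n (pd S i f)) S := by
  induction n with
  | zero => exact fun _ _ => rfl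
  | succ n ih =>
    rw [lapPow_succ, lapPow_succ]
    refine (pd_laplacianWithin hS ?_).trans (laplacianWithin_congr_set hS (ih (hf.of_le ?_)))
    · exact contDiffOn_lapPow (n := 3) hS n (contDiffOn_of_nat_le (by omega) hf)
    · exact_mod_cast (by omega : 2 * n + 1 ≤ 2 * (n + 1) + 1)

lemma lapPow_add (hS : IsRegularSet S) (n : ℕ) (hf : ContDiffOn ℝ (2 * n : ℕ) f S)
    (hg : ContDiffOn ℝ (2 * n : ℕ) g S) :
    EqOn (lapPow S n (fun x => f x + g x)) (fun x => lapPow S n f x + lapPow S n g x) S := by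
  induction n with
  | zero => exact fun _ _ => rfl
  | succ n ih =>
    have h1 : ((2 * n : ℕ) : WithTop ℕ∞) ≤ (2 * (n + 1) : ℕ) := by norm_cast; omega
    rw [lapPow_succ, lapPow_succ, lapPow_succ]
    refine (laplacianWithin_congr_set hS (ih (hf.of_le h1) (hg.of_le h1))).trans fun x hx => ?_
    have aux : ∀ {w : Rd d → ℝ}, ContDiffOn ℝ (2 * (n + 1) : ℕ) w S →
        ContDiffOn ℝ 2 (lapPow S n w) S := fun hw =>
      contDiffOn_lapPow (n := 2) hS n (contDiffOn_of_nat_le (by omega) hw)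
    exact ContDiffWithinAt.laplacianWithin_add (aux hf x hx) (aux hg x hx) hS.uniqueDiffOn hx

end Calculus

/-! ### Smooth domains: unique differentiability and decay at the boundary -/

section Domain

variable {d : ℕ} {Ω : Set (Rd d)} {ρ : Rd d → ℝ}

lemma IsDefiningFunction.isOpen (h : IsDefiningFunction Ω ρ) : IsOpen Ω := by
  rw [h.2.1]; exact isOpen_lt h.1.continuous continuous_const

lemma IsDefiningFunction.mem_iff (h : IsDefiningFunction Ω ρ) {x : Rd d} : x ∈ Ω ↔ ρ x < 0 := by
  conv_lhs => rw [h.2.1]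
  rfl

lemma IsDefiningFunction.nonpos_of_mem_closure (h : IsDefiningFunction Ω ρ) {x : Rd d}
    (hx : x ∈ closure Ω) : ρ x ≤ 0 :=
  closure_minimal (fun _ hy => (h.mem_iff.1 hy).le) (isClosed_le h.1.continuous continuous_const) hx

lemma IsDefiningFunction.eq_zero_of_mem_frontier (h : IsDefiningFunction Ω ρ) {x : Rd d}
    (hx : x ∈ frontier Ω) : ρ x = 0 := by
  rw [h.isOpen.frontier_eq] at hx
  exact le_antisymm (h.nonpos_of_mem_closure hx.1) (not_lt.1 fun hlt => hx.2 (h.mem_iff.2 hlt))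

lemma fderiv_eq_inner_gradient (x v : Rd d) :
    fderiv ℝ ρ x v = inner ℝ (gradient ρ x) v := by
  simp [gradient]

lemma IsDefiningFunction.differentiableAt (h : IsDefiningFunction Ω ρ) (x : Rd d) :
    DifferentiableAt ℝ ρ x := (h.1.differentiable (by simp)) x

lemma IsDefiningFunction.continuous_gradient (h : IsDefiningFunction Ω ρ) :
    Continuous (gradient ρ) :=
  (InnerProductSpace.toDual ℝ (Rd d)).symm.continuous.comp (h.1.continuous_fderiv (by simp))

lemma IsDefiningFunction.hasDerivAt_line (h : IsDefiningFunction Ω ρ) (x v : Rd d) (t : ℝ) :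
    HasDerivAt (fun s : ℝ => ρ (x + s • v)) (inner ℝ (gradient ρ (x + t • v)) v) t := by
  rw [← fderiv_eq_inner_gradient]
  have h1 : HasDerivAt (fun s : ℝ => x + s • v) v t := by
    simpa using ((hasDerivAt_id t).smul_const v).const_add x
  exact (h.differentiableAt _).hasFDerivAt.comp_hasDerivAt t h1

/-- Along a direction in which `ρ` strictly decreases, `x + t • v` lies in `{ρ < 0}` for all small
`t > 0`. -/
lemma IsDefiningFunction.mem_tangentConeAt (h : IsDefiningFunction Ω ρ) {x v : Rd d}
    (hx : ρ x = 0) (hv : inner ℝ (gradient ρ x) v < 0) : v ∈ tangentConeAt ℝ (closure Ω) x := by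
  refine mem_tangentConeAt_of_add_smul_mem (l := 𝓝[>] (0 : ℝ)) (c := id) ?_ ?_
  · exact tendsto_id'.2 (nhdsWithin_mono _ fun t ht => ne_of_gt ht)
  · have h1 := h.hasDerivAt_line x v 0
    simp only [zero_smul, add_zero] at h1
    have h2 := (hasDerivAt_iff_tendsto_slope_zero.1 h1).mono_left
      (nhdsWithin_mono 0 fun t (ht : 0 < t) => ne_of_gt ht)
    filter_upwards [h2.eventually_lt_const hv, self_mem_nhdsWithin] with t ht ht0
    apply subset_closure
    rw [h.mem_iff]
    simp only [zero_add, zero_smul, add_zero, hx, sub_zero, smul_eq_mul] at ht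
    exact (pos_iff_neg_of_mul_neg ht).1 (inv_pos.2 ht0)

/-- At a boundary point the tangent cone contains an open half-space, nonempty since the gradient of
`ρ` does not vanish there, and so it spans. -/
lemma IsDefiningFunction.uniqueDiffOn_closure (h : IsDefiningFunction Ω ρ) :
    UniqueDiffOn ℝ (closure Ω) := by
  intro x hx
  by_cases hxΩ : x ∈ Ω
  · exact (uniqueDiffWithinAt_of_mem_nhds
      (mem_of_superset (h.isOpen.mem_nhds hxΩ) subset_closure))
  · have hx0 : ρ x = 0 := h.eq_zero_of_mem_frontier (by rw [h.isOpen.frontier_eq]; exact ⟨hx, hxΩ⟩)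
    have hne := h.2.2 x hx0
    refine ⟨?_, subset_closure hx⟩
    have hsub : {v : Rd d | inner ℝ (gradient ρ x) v < 0} ⊆
        (Submodule.span ℝ (tangentConeAt ℝ (closure Ω) x) : Set (Rd d)) := fun v hv =>
      Submodule.subset_span (h.mem_tangentConeAt hx0 hv)
    have hop : IsOpen {v : Rd d | inner ℝ (gradient ρ x) v < 0} :=
      isOpen_lt (by fun_prop) continuous_const
    have : Submodule.span ℝ (tangentConeAt ℝ (closure Ω) x) = ⊤ := by
      refine Submodule.eq_top_of_nonempty_interior' _ ⟨-gradient ρ x, ?_⟩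
      refine interior_mono hsub ?_
      rw [hop.interior_eq]
      simp only [mem_ofPred_eq, inner_neg_right, real_inner_self_eq_norm_sq, neg_lt_zero]
      positivity
    rw [this]
    exact dense_univ

lemma IsDefiningFunction.isRegularSet_closure (h : IsDefiningFunction Ω ρ) :
    IsRegularSet (closure Ω) :=
  ⟨h.uniqueDiffOn_closure, closure_mono (interior_maximal subset_closure h.isOpen)⟩

lemma pd_closure_eq (hΩ : IsOpen Ω) {f : Rd d → ℝ} {i : Fin d} {x : Rd d} (hx : x ∈ Ω) :
    pd (closure Ω) i f x = fderiv ℝ f x (EuclideanSpace.single i 1) := by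
  rw [pd, fderivWithin_of_mem_nhds (mem_of_superset (hΩ.mem_nhds hx) subset_closure)]

lemma integrableOn_of_continuousOn_closure (hb : Bornology.IsBounded Ω) {f : Rd d → ℝ}
    (hf : ContinuousOn f (closure Ω)) : IntegrableOn f Ω :=
  (hf.integrableOn_compact hb.isCompact_closure).mono_set subset_closure

/-- From `x ∈ Ω` near `x₀` move in the direction `n = ∇ρ(x₀)`. There `ρ` grows at rate at least `c /
2`, so the boundary is reached within time `2|ρ x| / c`. `G` vanishes at the exit point and is
Lipschitz along the segment, which stays in `closure Ω`. -/
lemma IsDefiningFunction.abs_le_near_frontier (h : IsDefiningFunction Ω ρ)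
    {G : Rd d → ℝ} {L : ℝ} (hL : ∀ x ∈ closure Ω, ‖fderivWithin ℝ G (closure Ω) x‖ ≤ L)
    (hG : DifferentiableOn ℝ G (closure Ω)) (hG0 : ∀ x ∈ frontier Ω, G x = 0) {x₀ : Rd d}
    (hx₀ : x₀ ∈ frontier Ω) : ∃ C, ∀ᶠ x in 𝓝 x₀, x ∈ Ω → |G x| ≤ C * |ρ x| := by
  have hρ0 := h.eq_zero_of_mem_frontier hx₀
  have hn := h.2.2 x₀ hρ0
  set n := gradient ρ x₀
  have hnpos : 0 < ‖n‖ := norm_pos_iff.2 hn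
  set c := ‖n‖ ^ 2 with hc
  have hcpos : 0 < c := by positivity
  obtain ⟨r, hr, hball⟩ : ∃ r > 0, ∀ y ∈ Metric.ball x₀ r, c / 2 < inner ℝ (gradient ρ y) n := by
    have : ∀ᶠ y in 𝓝 x₀, c / 2 < inner ℝ (gradient ρ y) n := by
      have hcont : Continuous fun y => (inner ℝ (gradient ρ y) n : ℝ) :=
        h.continuous_gradient.inner continuous_const
      refine hcont.continuousAt.eventually_const_lt ?_
      change c / 2 < inner ℝ n n
      rw [real_inner_self_eq_norm_sq]
      linarith
    obtain ⟨r, hr, hb⟩ := Metric.eventually_nhds_iff_ball.1 this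
    exact ⟨r, hr, hb⟩
  set T := r / (2 * ‖n‖) with hT
  have hTpos : 0 < T := by positivity
  refine ⟨L * ‖n‖ * (2 / c), ?_⟩
  have hsmall : ∀ᶠ x in 𝓝 x₀, 2 / c * |ρ x| < T := by
    have hcont : Continuous fun x => 2 / c * |ρ x| :=
      continuous_const.mul h.1.continuous.abs
    refine hcont.continuousAt.eventually_lt_const ?_
    simpa [hρ0] using hTpos
  filter_upwards [Metric.ball_mem_nhds x₀ (half_pos hr), hsmall] with x hxb hxs hxΩ
  have hin : ∀ t ∈ Icc 0 T, x + t • n ∈ Metric.ball x₀ r := by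
    intro t ht
    rw [Metric.mem_ball, dist_eq_norm] at hxb ⊢
    calc ‖x + t • n - x₀‖ = ‖(x - x₀) + t • n‖ := by congr 1; abel
      _ ≤ ‖x - x₀‖ + ‖t • n‖ := norm_add_le _ _
      _ = ‖x - x₀‖ + t * ‖n‖ := by rw [norm_smul, Real.norm_of_nonneg ht.1]
      _ < r / 2 + T * ‖n‖ := by
        have := mul_le_mul_of_nonneg_right ht.2 hnpos.le
        linarith
      _ = r := by rw [hT]; field_simp; ring
  have hgrow : ∀ s ∈ Icc 0 T, ∀ t ∈ Icc 0 T, s ≤ t →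
      c / 2 * (t - s) ≤ ρ (x + t • n) - ρ (x + s • n) := by
    refine (convex_Icc 0 T).mul_sub_le_image_sub_of_le_deriv (f := fun t : ℝ => ρ (x + t • n)) ?_ ?_ ?_
    · exact fun t _ => (h.hasDerivAt_line x n t).continuousAt.continuousWithinAt
    · exact fun t _ => (h.hasDerivAt_line x n t).differentiableAt.differentiableWithinAt
    · intro t ht
      rw [(h.hasDerivAt_line x n t).deriv]
      exact (hball _ (hin t (interior_subset ht))).le
  have hρx : ρ x < 0 := h.mem_iff.1 hxΩ
  -- By this time growth at rate `c / 2` has made `ρ` nonnegative, so a zero lies in between.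
  set t₁ := 2 / c * |ρ x| with ht₁
  have ht₁pos : 0 ≤ t₁ := by positivity
  have hend : 0 ≤ ρ (x + t₁ • n) := by
    have := hgrow 0 ⟨le_rfl, hTpos.le⟩ t₁ ⟨ht₁pos, hxs.le⟩ ht₁pos
    have h2 : c / 2 * (t₁ - 0) = -ρ x := by
      rw [ht₁, abs_of_neg hρx]; field_simp; ring
    rw [h2] at this
    simp only [zero_smul, add_zero] at this
    linarith
  obtain ⟨t, ht, htz⟩ : ∃ t ∈ Icc 0 t₁, ρ (x + t • n) = 0 := by
    have hcont : ContinuousOn (fun t : ℝ => ρ (x + t • n)) (Icc 0 t₁) := fun t _ =>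
      (h.hasDerivAt_line x n t).continuousAt.continuousWithinAt
    exact intermediate_value_Icc ht₁pos hcont ⟨by simpa using hρx.le, hend⟩
  have hmemT : ∀ s ∈ Icc 0 t, s ∈ Icc 0 T := fun s hs => ⟨hs.1, by linarith [hs.2, ht.2]⟩
  have hΩs : ∀ s ∈ Ico 0 t, x + s • n ∈ Ω := by
    intro s hs
    rw [h.mem_iff]
    have := hgrow s (hmemT s ⟨hs.1, hs.2.le⟩) t (hmemT t ⟨ht.1, le_rfl⟩) hs.2.le
    rw [htz] at this
    have h3 : 0 < c / 2 * (t - s) := by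
      have := sub_pos.2 hs.2
      positivity
    linarith
  have hcl : ∀ s ∈ Icc 0 t, x + s • n ∈ closure Ω := by
    intro s hs
    rcases hs.2.lt_or_eq with hlt | rfl
    · exact subset_closure (hΩs s ⟨hs.1, hlt⟩)
    · rcases hs.1.eq_or_lt with h0 | h0
      · rw [← h0]; simpa using subset_closure hxΩ
      · have hcont : Continuous fun u : ℝ => x + u • n := by fun_prop
        have hmem : s ∈ closure (Ico 0 s) := by
          rw [closure_Ico h0.ne]; exact ⟨h0.le, le_rfl⟩
        have := image_closure_subset_closure_image hcont ⟨s, hmem, rfl⟩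
        refine closure_mono ?_ this
        rintro _ ⟨u, hu, rfl⟩
        exact hΩs u hu
  have hfr : x + t • n ∈ frontier Ω := by
    rw [h.isOpen.frontier_eq]
    exact ⟨hcl t ⟨ht.1, le_rfl⟩, fun hmem => (h.mem_iff.1 hmem).ne htz⟩
  have hseg : segment ℝ x (x + t • n) ⊆ closure Ω := by
    intro y hy
    rw [segment_eq_image'] at hy
    obtain ⟨θ, hθ, rfl⟩ := hy
    have : x + θ • (x + t • n - x) = x + (θ * t) • n := by
      rw [add_sub_cancel_left, smul_smul]
    simp only [this]
    exact hcl _ ⟨mul_nonneg hθ.1 ht.1, by nlinarith [hθ.2, ht.1]⟩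
  have hmv := (convex_segment x (x + t • n)).norm_image_sub_le_of_norm_hasFDerivWithin_le (f := G)
    (fun y hy => ((hG y (hseg hy)).hasFDerivWithinAt).mono hseg) (fun y hy => hL y (hseg hy))
    (right_mem_segment ℝ _ _) (left_mem_segment ℝ _ _)
  rw [hG0 _ hfr, sub_zero, Real.norm_eq_abs] at hmv
  have hL0 : 0 ≤ L := (norm_nonneg _).trans (hL x (subset_closure hxΩ))
  calc |G x| ≤ L * ‖x - (x + t • n)‖ := hmv
    _ = L * (t * ‖n‖) := by
      rw [sub_add_cancel_left, norm_neg, norm_smul, Real.norm_of_nonneg ht.1]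
    _ ≤ L * (t₁ * ‖n‖) := by gcongr; exact ht.2
    _ = L * ‖n‖ * (2 / c) * |ρ x| := by rw [ht₁]; ring

/-- The local bounds are patched together by compactness of `closure Ω`; near an interior point
there is nothing to prove, since `ρ` stays away from zero. -/
lemma IsDefiningFunction.exists_abs_le (h : IsDefiningFunction Ω ρ) (hb : Bornology.IsBounded Ω)
    {G : Rd d → ℝ} (hG : ContDiffOn ℝ 1 G (closure Ω)) (hG0 : ∀ x ∈ frontier Ω, G x = 0) :
    ∃ C, ∀ x ∈ Ω, |G x| ≤ C * |ρ x| := by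
  have hcomp : IsCompact (closure Ω) := hb.isCompact_closure
  obtain ⟨L, hL⟩ := hcomp.exists_bound_of_continuousOn
    (hG.continuousOn_fderivWithin h.uniqueDiffOn_closure (by norm_num))
  have hdiff : DifferentiableOn ℝ G (closure Ω) := hG.differentiableOn (by norm_num)
  have hloc : ∀ x₀ ∈ closure Ω, ∃ C, ∀ᶠ x in 𝓝 x₀, x ∈ Ω → |G x| ≤ C * |ρ x| := by
    intro x₀ hx₀
    by_cases hxΩ : x₀ ∈ Ω
    · have hρ : 0 < |ρ x₀| := abs_pos.2 (h.mem_iff.1 hxΩ).ne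
      have hGc : ContinuousAt G x₀ := hdiff.continuousOn.continuousAt
        (mem_of_superset (h.isOpen.mem_nhds hxΩ) subset_closure)
      refine ⟨(|G x₀| + 1) / (|ρ x₀| / 2), ?_⟩
      filter_upwards [hGc.abs.eventually_lt_const (lt_add_one _),
        (h.1.continuous.abs.continuousAt (x := x₀)).eventually_const_lt (half_lt_self hρ)]
        with x h1 h2 _
      rw [div_mul_eq_mul_div, le_div_iff₀ (by positivity)]
      exact mul_le_mul h1.le h2.le (by positivity) (by positivity)
    · exact h.abs_le_near_frontier hL hdiff hG0 (by rw [h.isOpen.frontier_eq]; exact ⟨hx₀, hxΩ⟩)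
  have key : ∃ C, ∀ x ∈ closure Ω, x ∈ Ω → |G x| ≤ C * |ρ x| := by
    refine hcomp.induction_on (p := fun s => ∃ C, ∀ x ∈ s, x ∈ Ω → |G x| ≤ C * |ρ x|)
      ⟨0, by simp⟩ ?_ ?_ ?_
    · rintro s t hst ⟨C, hC⟩
      exact ⟨C, fun x hx => hC x (hst hx)⟩
    · rintro s t ⟨C, hC⟩ ⟨C', hC'⟩
      refine ⟨max C C', ?_⟩
      rintro x (hx | hx) hxΩ
      · exact (hC x hx hxΩ).trans (by gcongr; exact le_max_left _ _)
      · exact (hC' x hx hxΩ).trans (by gcongr; exact le_max_right _ _)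
    · intro x hx
      obtain ⟨C, hC⟩ := hloc x hx
      exact ⟨_, mem_nhdsWithin_of_mem_nhds hC, C, fun y hy => hy⟩
  obtain ⟨C, hC⟩ := key
  exact ⟨C, fun x hx => hC x (subset_closure hx) hx⟩

/-! ### The divergence theorem for fields that are tangential on the boundary -/

/-- `F` is smooth in `Ω` only, but every product with `χ` or its derivative extends by zero to an
integrable function on the whole space. -/
lemma integral_mul_fderiv_of_tsupport_subset (hΩ : IsOpen Ω) {χ F : Rd d → ℝ}
    (hχ : ContDiff ℝ 1 χ) (hc : HasCompactSupport χ) (hs : tsupport χ ⊆ Ω)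
    (hF : ContDiffOn ℝ 1 F Ω) (v : Rd d) :
    ∫ x in Ω, χ x * fderiv ℝ F x v = - ∫ x in Ω, fderiv ℝ χ x v * F x := by
  have hF' : ContinuousOn (fun x => fderiv ℝ F x v) Ω :=
    (hF.continuousOn_fderiv_of_isOpen hΩ (by norm_num)).clm_apply continuousOn_const
  have hχ' : Continuous fun x => fderiv ℝ χ x v :=
    (hχ.continuous_fderiv (by norm_num)).clm_apply continuous_const
  have hts : tsupport (fun x => fderiv ℝ χ x v) ⊆ tsupport χ := by
    refine closure_minimal (fun x hx => support_fderiv_subset ℝ (fun h => hx ?_))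
      (isClosed_tsupport _)
    simp [h]
  have aux : ∀ {a b : Rd d → ℝ}, Continuous a → tsupport a ⊆ tsupport χ → ContinuousOn b Ω →
      Integrable (fun x => a x * b x) := by
    intro a b ha hsa hb
    have hsub : tsupport (fun x => a x * b x) ⊆ tsupport a := tsupport_mul_subset_left
    refine Continuous.integrable_of_hasCompactSupport ?_ ?_
    · exact ContinuousOn.continuous_of_tsupport_subset (ha.continuousOn.mul hb) hΩ
        (hsub.trans (hsa.trans hs))
    · exact HasCompactSupport.of_support_subset_isCompact hc
        ((subset_tsupport _).trans (hsub.trans hsa))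
  have hout : ∀ x ∉ Ω, χ x = 0 := fun x hx =>
    image_eq_zero_of_notMem_tsupport fun h => hx (hs h)
  have hout' : ∀ x ∉ Ω, fderiv ℝ χ x v = 0 := fun x hx =>
    image_eq_zero_of_notMem_tsupport (f := fun x => fderiv ℝ χ x v) fun h => hx (hs (hts h))
  rw [setIntegral_eq_integral_of_forall_compl_eq_zero fun x hx => by rw [hout x hx, zero_mul],
    setIntegral_eq_integral_of_forall_compl_eq_zero fun x hx => by rw [hout' x hx, zero_mul]]
  refine integral_mul_fderiv_eq_neg_fderiv_mul_of_integrable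
    (aux hχ' hts hF.continuousOn) (aux hχ.continuous le_rfl hF')
    (aux hχ.continuous le_rfl hF.continuousOn)
    (fun x _ => hχ.differentiable (by norm_num) x) fun x hx => ?_
  exact (hF.differentiableOn (by norm_num)).differentiableAt (hΩ.mem_nhds (hs hx))

end Domain

lemma exists_bound_deriv_smoothTransition :
    ∃ M, 0 ≤ M ∧ ∀ t, |deriv Real.smoothTransition t| ≤ M ∧
      (t ∉ Icc (0 : ℝ) 1 → deriv Real.smoothTransition t = 0) := by
  have hc : Continuous (deriv Real.smoothTransition) :=
    (Real.smoothTransition.contDiff (n := 1)).continuous_deriv (by norm_num)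
  obtain ⟨M, hM⟩ := isCompact_Icc.exists_bound_of_continuousOn (hc.continuousOn (s := Icc (0 : ℝ) 1))
  have hM0 : 0 ≤ M := (norm_nonneg _).trans (hM 0 ⟨le_rfl, zero_le_one⟩)
  have hz : ∀ t, t ∉ Icc (0 : ℝ) 1 → deriv Real.smoothTransition t = 0 := by
    intro t ht
    rw [mem_Icc, not_and_or, not_le, not_le] at ht
    rcases ht with ht | ht
    · have : Real.smoothTransition =ᶠ[𝓝 t] fun _ => 0 := by
        filter_upwards [Iio_mem_nhds ht] with s hs
        exact Real.smoothTransition.zero_of_nonpos (le_of_lt hs)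
      rw [this.deriv_eq, deriv_const]
    · have : Real.smoothTransition =ᶠ[𝓝 t] fun _ => 1 := by
        filter_upwards [Ioi_mem_nhds ht] with s hs
        exact Real.smoothTransition.one_of_one_le (le_of_lt hs)
      rw [this.deriv_eq, deriv_const]
  refine ⟨M, hM0, fun t => ⟨?_, hz t⟩⟩
  by_cases ht : t ∈ Icc (0 : ℝ) 1
  · exact hM t ht
  · rw [hz t ht, abs_zero]; exact hM0

section Domain

variable {d : ℕ} {Ω : Set (Rd d)} {ρ : Rd d → ℝ}

/-- A cutoff function that vanishes where `ρ ≥ -1 / (n + 1)` and is `1` where `ρ ≤ -2 / (n + 1)`. -/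
noncomputable def innerCutoff (ρ : Rd d → ℝ) (n : ℕ) (x : Rd d) : ℝ :=
  Real.smoothTransition (-(n + 1 : ℝ) * ρ x - 1)

lemma IsDefiningFunction.contDiff_innerCutoff (h : IsDefiningFunction Ω ρ) (n : ℕ) :
    ContDiff ℝ 1 (innerCutoff ρ n) :=
  (Real.smoothTransition.contDiff (n := 1)).comp
    ((contDiff_const.mul (h.1.of_le (by norm_cast))).sub contDiff_const)

lemma IsDefiningFunction.tsupport_innerCutoff (h : IsDefiningFunction Ω ρ) (n : ℕ) :
    tsupport (innerCutoff ρ n) ⊆ Ω := by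
  have hcl : IsClosed {x | ρ x ≤ -(1 / (n + 1 : ℝ))} := isClosed_le h.1.continuous continuous_const
  have hsub : tsupport (innerCutoff ρ n) ⊆ {x | ρ x ≤ -(1 / (n + 1 : ℝ))} := by
    refine closure_minimal (fun x hx => ?_) hcl
    by_contra hlt
    simp only [mem_ofPred_eq, not_le] at hlt
    refine hx (Real.smoothTransition.zero_of_nonpos ?_)
    have hn : (0 : ℝ) < n + 1 := by positivity
    have : (n + 1 : ℝ) * -(1 / (n + 1 : ℝ)) = -1 := by field_simp
    nlinarith [mul_lt_mul_of_pos_left hlt hn]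
  intro x hx
  have h1 : ρ x ≤ -(1 / (n + 1 : ℝ)) := hsub hx
  refine h.mem_iff.2 (h1.trans_lt ?_)
  have : (0 : ℝ) < 1 / (n + 1) := by positivity
  linarith

lemma IsDefiningFunction.fderiv_innerCutoff (h : IsDefiningFunction Ω ρ) (n : ℕ) (x v : Rd d) :
    fderiv ℝ (innerCutoff ρ n) x v =
      deriv Real.smoothTransition (-(n + 1 : ℝ) * ρ x - 1) * (-(n + 1 : ℝ) * fderiv ℝ ρ x v) := by
  have h1 : HasFDerivAt (fun y => -(n + 1 : ℝ) * ρ y - 1) (-(n + 1 : ℝ) • fderiv ℝ ρ x) x :=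
    ((h.differentiableAt x).hasFDerivAt.const_mul _).sub_const _
  have h2 : HasDerivAt Real.smoothTransition
      (deriv Real.smoothTransition (-(n + 1 : ℝ) * ρ x - 1)) (-(n + 1 : ℝ) * ρ x - 1) :=
    ((Real.smoothTransition.contDiff (n := 1)).differentiable (by norm_num) _).hasDerivAt
  have h3 := h2.comp_hasFDerivAt x h1
  have h4 : fderiv ℝ (innerCutoff ρ n) x = _ := h3.fderiv
  rw [h4]
  simp

lemma gradient_apply_eq (x : Rd d) (i : Fin d) :
    gradient ρ x i = fderiv ℝ ρ x (EuclideanSpace.single i 1) := by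
  rw [fderiv_eq_inner_gradient, EuclideanSpace.inner_single_right]
  simp

lemma IsDefiningFunction.contDiff_gradient_apply (h : IsDefiningFunction Ω ρ) (i : Fin d) :
    ContDiff ℝ 1 (fun x => gradient ρ x i) := by
  simp only [gradient_apply_eq]
  exact (h.1.fderiv_right (m := 1) (by norm_cast)).clm_apply contDiff_const

/-- The divergence theorem for a field that is tangential on the boundary. -/
theorem IsDefiningFunction.integral_div_eq_zero (h : IsDefiningFunction Ω ρ)
    (hb : Bornology.IsBounded Ω) {X : Fin d → Rd d → ℝ}
    (hX : ∀ i, ContDiffOn ℝ 1 (X i) (closure Ω))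
    (htan : ∀ x ∈ frontier Ω, ∑ i, X i x * gradient ρ x i = 0) :
    ∫ x in Ω, ∑ i, pd (closure Ω) i (X i) x = 0 := by
  have hS := h.isRegularSet_closure
  have hmeas : MeasurableSet Ω := h.isOpen.measurableSet
  have hfin : volume Ω < ⊤ := hb.measure_lt_top
  have : IsFiniteMeasure (volume.restrict Ω) := ⟨by simpa using hfin⟩
  obtain ⟨M, hM0, hM⟩ := exists_bound_deriv_smoothTransition
  -- Tangentiality in quantitative form: `|X · ∇ρ| ≤ C |ρ|` in all of `Ω`.
  obtain ⟨C, hC⟩ := h.exists_abs_le hb (G := fun x => ∑ i, X i x * gradient ρ x i)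
    (ContDiffOn.sum fun i _ => (hX i).mul (h.contDiff_gradient_apply i).contDiffOn) htan
  have hdivc : ContinuousOn (fun x => ∑ i, pd (closure Ω) i (X i) x) (closure Ω) :=
    continuousOn_finsetSum _ fun i _ =>
      (contDiffOn_pd (n := 0) hS (by simpa using hX i)).continuousOn
  have hdivi : IntegrableOn (fun x => ∑ i, pd (closure Ω) i (X i) x) Ω :=
    integrableOn_of_continuousOn_closure hb hdivc
  have hcast : Tendsto (fun n : ℕ => (n + 1 : ℝ)) atTop atTop :=
    tendsto_atTop_add_const_right _ _ tendsto_natCast_atTop_atTop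
  have hev : ∀ x ∈ Ω, ∀ᶠ n : ℕ in atTop, 2 < -(n + 1 : ℝ) * ρ x := by
    intro x hx
    have hρ : 0 < -ρ x := neg_pos.2 (h.mem_iff.1 hx)
    filter_upwards [(hcast.atTop_mul_const hρ).eventually_gt_atTop 2] with n hn
    linarith
  have hlim1 : Tendsto (fun n => ∫ x in Ω, innerCutoff ρ n x * ∑ i, pd (closure Ω) i (X i) x) atTop
      (𝓝 (∫ x in Ω, ∑ i, pd (closure Ω) i (X i) x)) := by
    refine tendsto_integral_of_dominated_convergence
      (fun x => |∑ i, pd (closure Ω) i (X i) x|) ?_ hdivi.abs ?_ ?_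
    · exact fun n => (h.contDiff_innerCutoff n).continuous.aestronglyMeasurable.mul
        hdivi.aestronglyMeasurable
    · refine fun n => Eventually.of_forall fun x => ?_
      rw [norm_mul, Real.norm_eq_abs, Real.norm_eq_abs]
      refine mul_le_of_le_one_left (abs_nonneg _) ?_
      unfold innerCutoff
      rw [abs_of_nonneg (Real.smoothTransition.nonneg _)]
      exact Real.smoothTransition.le_one _
    · refine (ae_restrict_iff' hmeas).2 (Eventually.of_forall fun x hx => ?_)
      refine tendsto_const_nhds.congr' ?_
      filter_upwards [hev x hx] with n hn
      unfold innerCutoff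
      rw [Real.smoothTransition.one_of_one_le (by linarith), one_mul]
  -- The gradient of the cutoff is of size `n`, but it lives where `(n + 1)|ρ| ≤ 2`. There `(n +
  -- 1)|X · ∇ρ| ≤ 2|C|`, so the integrands are uniformly bounded. At a fixed point of `Ω` they
  -- vanish for large `n`.
  have hlim2 : Tendsto (fun n => ∫ x in Ω, ∑ i, fderiv ℝ (innerCutoff ρ n) x
      (EuclideanSpace.single i 1) * X i x) atTop (𝓝 (∫ x in Ω, (0 : ℝ))) := by
    have hform : ∀ (n : ℕ) (x : Rd d), ∑ i, fderiv ℝ (innerCutoff ρ n) x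
        (EuclideanSpace.single i 1) * X i x =
        deriv Real.smoothTransition (-(n + 1 : ℝ) * ρ x - 1) *
          (-(n + 1 : ℝ) * ∑ i, X i x * gradient ρ x i) := by
      intro n x
      simp only [h.fderiv_innerCutoff, gradient_apply_eq, Finset.mul_sum]
      exact Finset.sum_congr rfl fun i _ => by ring
    refine tendsto_integral_of_dominated_convergence (fun _ => M * (2 * |C|)) ?_
      (integrable_const _) ?_ ?_
    · intro n
      refine (ContinuousOn.aestronglyMeasurable ?_ hmeas)
      refine continuousOn_finsetSum _ fun i _ => ?_
      exact ((((h.contDiff_innerCutoff n).continuous_fderiv (by norm_num)).clm_apply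
        continuous_const).continuousOn).mul ((hX i).continuousOn.mono subset_closure)
    · refine fun n => (ae_restrict_iff' hmeas).2 (Eventually.of_forall fun x hx => ?_)
      rw [hform, norm_mul, Real.norm_eq_abs, Real.norm_eq_abs]
      by_cases hin : -(n + 1 : ℝ) * ρ x - 1 ∈ Icc (0 : ℝ) 1
      · refine mul_le_mul (hM _).1 ?_ (abs_nonneg _) hM0
        have hn : (0 : ℝ) < n + 1 := by positivity
        rw [abs_mul, abs_neg, abs_of_pos hn]
        have hρ := h.mem_iff.1 hx
        have h1 := hC x hx
        have h2 : (n + 1 : ℝ) * |ρ x| ≤ 2 := by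
          rw [abs_of_neg hρ]; linarith [hin.2]
        calc (n + 1 : ℝ) * |∑ i, X i x * gradient ρ x i| ≤ (n + 1 : ℝ) * (C * |ρ x|) := by gcongr
          _ ≤ (n + 1 : ℝ) * (|C| * |ρ x|) := by gcongr; exact le_abs_self C
          _ = (n + 1 : ℝ) * |ρ x| * |C| := by ring
          _ ≤ 2 * |C| := by gcongr
      · rw [(hM _).2 hin, abs_zero, zero_mul]; positivity
    · refine (ae_restrict_iff' hmeas).2 (Eventually.of_forall fun x hx => ?_)
      refine tendsto_const_nhds.congr' ?_
      filter_upwards [hev x hx] with n hn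
      rw [hform, (hM _).2 fun hin => by linarith [hin.2], zero_mul]
  have heq : ∀ n, ∫ x in Ω, innerCutoff ρ n x * ∑ i, pd (closure Ω) i (X i) x =
      - ∫ x in Ω, ∑ i, fderiv ℝ (innerCutoff ρ n) x (EuclideanSpace.single i 1) * X i x := by
    intro n
    have hcs : HasCompactSupport (innerCutoff ρ n) :=
      HasCompactSupport.of_support_subset_isCompact hb.isCompact_closure
        ((subset_tsupport _).trans ((h.tsupport_innerCutoff n).trans subset_closure))
    simp only [Finset.mul_sum]
    rw [integral_finsetSum, integral_finsetSum, ← Finset.sum_neg_distrib]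
    · refine Finset.sum_congr rfl fun i _ => ?_
      rw [← integral_mul_fderiv_of_tsupport_subset h.isOpen (h.contDiff_innerCutoff n) hcs
        (h.tsupport_innerCutoff n) ((hX i).mono subset_closure)]
      exact setIntegral_congr_fun hmeas fun x hx => by simp only [pd_closure_eq h.isOpen hx]
    · exact fun i _ => integrableOn_of_continuousOn_closure hb
        ((((h.contDiff_innerCutoff n).continuous_fderiv (by norm_num)).clm_apply
          continuous_const).continuousOn.mul (hX i).continuousOn)
    · exact fun i _ => integrableOn_of_continuousOn_closure hb
        ((h.contDiff_innerCutoff n).continuous.continuousOn.mul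
          (contDiffOn_pd (n := 0) hS (by simpa using hX i)).continuousOn)
  have h1 := hlim1
  simp only [heq] at h1
  have h2 := tendsto_nhds_unique h1 hlim2.neg
  rw [h2]
  simp

/-- Apply the divergence theorem to the field `f w eᵢ`, which vanishes on the boundary. -/
lemma IsDefiningFunction.integral_mul_pd (h : IsDefiningFunction Ω ρ) (hb : Bornology.IsBounded Ω)
    {f w : Rd d → ℝ} (hf : ContDiffOn ℝ 1 f (closure Ω)) (hw : ContDiffOn ℝ 1 w (closure Ω))
    (hw0 : ∀ x ∈ frontier Ω, w x = 0) (i : Fin d) :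
    ∫ x in Ω, f x * pd (closure Ω) i w x = - ∫ x in Ω, pd (closure Ω) i f x * w x := by
  have hS := h.isRegularSet_closure
  have key := h.integral_div_eq_zero hb (X := fun j => if j = i then fun x => f x * w x else 0)
    (fun j => by
      split_ifs
      · exact hf.mul hw
      · exact contDiffOn_const)
    (fun x hx => Finset.sum_eq_zero fun j _ => by
      split_ifs
      · simp [hw0 x hx]
      · simp)
  have hsum : ∀ x ∈ Ω, ∑ j, pd (closure Ω) j (if j = i then fun x => f x * w x else 0) x =
      f x * pd (closure Ω) i w x + pd (closure Ω) i f x * w x := by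
    intro x hx
    rw [Finset.sum_eq_single i]
    · simp only [if_true]
      exact pd_mul hS (hf.differentiableOn (by norm_num)) (hw.differentiableOn (by norm_num))
        (subset_closure hx)
    · intro j _ hj
      simp [hj, pd, Pi.zero_def]
    · simp
  rw [setIntegral_congr_fun h.isOpen.measurableSet hsum, integral_add] at key
  · linarith
  · exact integrableOn_of_continuousOn_closure hb (hf.continuousOn.mul
      (contDiffOn_pd (n := 0) hS (by simpa using hw)).continuousOn)
  · exact integrableOn_of_continuousOn_closure hb
      ((contDiffOn_pd (n := 0) hS (by simpa using hf)).continuousOn.mul hw.continuousOn)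

/-- Green's first identity, without boundary term. -/
lemma IsDefiningFunction.integral_laplacian_mul (h : IsDefiningFunction Ω ρ)
    (hb : Bornology.IsBounded Ω) {f w : Rd d → ℝ} (hf : ContDiffOn ℝ 2 f (closure Ω))
    (hw : ContDiffOn ℝ 1 w (closure Ω))
    (hbd : ∀ x ∈ frontier Ω, (∑ i, pd (closure Ω) i f x * gradient ρ x i = 0) ∨ w x = 0) :
    ∫ x in Ω, InnerProductSpace.laplacianWithin f (closure Ω) x * w x =
      - ∑ i, ∫ x in Ω, pd (closure Ω) i f x * pd (closure Ω) i w x := by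
  have hS := h.isRegularSet_closure
  have hf' : ContDiffOn ℝ (1 + 1 : ℕ) f (closure Ω) := by simpa using hf
  have hpf : ∀ i, ContDiffOn ℝ 1 (pd (closure Ω) i f) (closure Ω) := fun i => by
    simpa using contDiffOn_pd (i := i) hS hf'
  have hpw : ∀ i, ContinuousOn (pd (closure Ω) i w) (closure Ω) := fun i =>
    (contDiffOn_pd (n := 0) hS (by simpa using hw)).continuousOn
  -- The field `w ∇f` is tangential as soon as, at each boundary point, either the normal derivative
  -- of `f` or `w` itself vanishes.
  have key := h.integral_div_eq_zero hb (X := fun i x => pd (closure Ω) i f x * w x)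
    (fun i => (hpf i).mul hw) (fun x hx => by
      rcases hbd x hx with h0 | h0
      · calc ∑ i, pd (closure Ω) i f x * w x * gradient ρ x i
            = w x * ∑ i, pd (closure Ω) i f x * gradient ρ x i := by
              rw [Finset.mul_sum]; exact Finset.sum_congr rfl fun i _ => by ring
          _ = 0 := by rw [h0, mul_zero]
      · simp [h0])
  have hsum : ∀ x ∈ Ω, ∑ i, pd (closure Ω) i (fun x => pd (closure Ω) i f x * w x) x =
      InnerProductSpace.laplacianWithin f (closure Ω) x * w x +
        ∑ i, pd (closure Ω) i f x * pd (closure Ω) i w x := by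
    intro x hx
    rw [laplacianWithin_eqOn hS hf (subset_closure hx), Finset.sum_mul, ← Finset.sum_add_distrib]
    refine Finset.sum_congr rfl fun i _ => ?_
    rw [pd_mul hS ((hpf i).differentiableOn (by norm_num)) (hw.differentiableOn (by norm_num))
      (subset_closure hx)]
    ring
  have hi : ∀ i, IntegrableOn (fun x => pd (closure Ω) i f x * pd (closure Ω) i w x) Ω := fun i =>
    integrableOn_of_continuousOn_closure hb ((hpf i).continuousOn.mul (hpw i))
  rw [setIntegral_congr_fun h.isOpen.measurableSet hsum, integral_add,
    integral_finsetSum _ fun i _ => hi i] at key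
  · linarith
  · exact integrableOn_of_continuousOn_closure hb
      ((contDiffOn_laplacianWithin (n := 0) hS (by simpa using hf)).continuousOn.mul hw.continuousOn)
  · exact integrable_finsetSum _ fun i _ => hi i

/-- Green's identity for the powers of the Laplacian, without boundary terms. -/
theorem IsDefiningFunction.integral_lapPow_mul (h : IsDefiningFunction Ω ρ)
    (hb : Bornology.IsBounded Ω) (n : ℕ) : ∀ {f w : Rd d → ℝ},
    ContDiffOn ℝ (2 * n : ℕ) f (closure Ω) → ContDiffOn ℝ n w (closure Ω) →
    (∀ (L : List (Fin d)) (j : ℕ), L.length + j + 1 = n → ∀ x ∈ frontier Ω,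
      (∑ i, pd (closure Ω) i (pdl (closure Ω) L (lapPow (closure Ω) j f)) x * gradient ρ x i = 0) ∨
        pdl (closure Ω) L w x = 0) →
    ∫ x in Ω, lapPow (closure Ω) n f x * w x = (-1) ^ n * ∑ s : Fin n → Fin d,
      ∫ x in Ω, pdl (closure Ω) (List.ofFn s) f x * pdl (closure Ω) (List.ofFn s) w x := by
  have hS := h.isRegularSet_closure
  induction n with
  | zero => intro f w _ _ _; simp
  | succ n ih =>
    intro f w hf hw hbd
    have hfr : frontier Ω ⊆ closure Ω := frontier_subset_closure
    rw [lapPow_succ, h.integral_laplacian_mul hb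
      (contDiffOn_lapPow (n := 2) hS n (contDiffOn_of_nat_le (by omega) hf))
      (contDiffOn_of_nat_le (m := 1) (by omega) hw |>.of_le (by simp))
      (fun x hx => by simpa using hbd [] n (by simp) x hx)]
    -- After one use of Green's identity, `∂ᵢ` commutes with `Δ^n` and the induction hypothesis
    -- applies to `∂ᵢ f` and `∂ᵢ w`. The direction `i` acts first, so it becomes the last letter of
    -- the word, whence `Fin.snoc`.
    have hstep : ∀ i : Fin d,
        ∫ x in Ω, pd (closure Ω) i (lapPow (closure Ω) n f) x * pd (closure Ω) i w x =
        (-1) ^ n * ∑ s : Fin n → Fin d, ∫ x in Ω,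
          pdl (closure Ω) (List.ofFn (Fin.snoc s i : Fin (n + 1) → Fin d)) f x *
          pdl (closure Ω) (List.ofFn (Fin.snoc s i : Fin (n + 1) → Fin d)) w x := by
      intro i
      have h1 := ih (f := pd (closure Ω) i f) (w := pd (closure Ω) i w)
        (contDiffOn_pd hS (contDiffOn_of_nat_le (by omega) hf)) (contDiffOn_pd hS hw) (by
          intro L j hLj x hx
          -- The boundary alternative for `∂ᵢ f, ∂ᵢ w` and the word `L` is the one for `f, w` and
          -- the longer word `L ++ [i]`.
          have h2 := hbd (L ++ [i]) j (by simp; omega) x hx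
          rw [pdl_append, pdl_append] at h2
          refine h2.imp (fun h2 => ?_) id
          rw [← h2]
          refine Finset.sum_congr rfl fun l _ => ?_
          congr 1
          refine pd_congr (pdl_congr ?_ L) (hfr hx)
          exact (pd_lapPow hS j (contDiffOn_of_nat_le (by omega) hf)).symm)
      have h3 : ∀ x ∈ Ω, pd (closure Ω) i (lapPow (closure Ω) n f) x * pd (closure Ω) i w x =
          lapPow (closure Ω) n (pd (closure Ω) i f) x * pd (closure Ω) i w x := fun x hx => by
        rw [pd_lapPow hS n (contDiffOn_of_nat_le (by omega) hf) (subset_closure hx)]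
      rw [setIntegral_congr_fun h.isOpen.measurableSet h3, h1]
      congr 1
      refine Finset.sum_congr rfl fun s _ => ?_
      have h4 : List.ofFn (Fin.snoc s i : Fin (n + 1) → Fin d) = List.ofFn s ++ [i] := by
        rw [List.ofFn_succ']
        simp [List.concat_eq_append]
      rw [h4]
      simp only [pdl_append]
      rfl
    simp only [hstep]
    rw [← Finset.mul_sum, pow_succ, mul_assoc, neg_one_mul, ← mul_neg]
    congr 2
    rw [← (Fin.snocEquiv fun _ : Fin (n + 1) => Fin d).sum_comp, Fintype.sum_prod_type]
    rfl

end Domain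

/-! ### The energy density: pointwise lower bound and absorption -/

/-- For `t ≥ b / a` the term `a t^γ` dominates; for smaller `t` the left side is at most its value
at `b / a`. -/
lemma exists_mul_rpow_sub_one_le {γ a b : ℝ} (hγ : 1 < γ) (ha : 0 < a) (hb : 0 ≤ b) :
    ∃ K, 0 ≤ K ∧ ∀ t, 0 ≤ t → b * t ^ (γ - 1) ≤ a * t ^ γ + K := by
  refine ⟨b * (b / a) ^ (γ - 1), by positivity, fun t ht => ?_⟩
  rcases le_total (b / a) t with hT | hT
  · have h1 : t ^ γ = t * t ^ (γ - 1) := by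
      rcases ht.eq_or_lt with rfl | h0
      · rw [Real.zero_rpow (by linarith), zero_mul]
      · rw [← Real.rpow_one_add' ht (by linarith)]; congr 1; ring
    have h2 : b ≤ a * t := by rwa [div_le_iff₀' ha] at hT
    have h3 : b * t ^ (γ - 1) ≤ a * t * t ^ (γ - 1) := by gcongr
    rw [h1, ← mul_assoc]
    have : 0 ≤ b * (b / a) ^ (γ - 1) := by positivity
    linarith
  · have h1 : t ^ (γ - 1) ≤ (b / a) ^ (γ - 1) := Real.rpow_le_rpow ht hT (by linarith)
    have h2 : b * t ^ (γ - 1) ≤ b * (b / a) ^ (γ - 1) := by gcongr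
    have : 0 ≤ a * t ^ γ := by positivity
    linarith

lemma half_sq_sub_le (x y : ℝ) : 1 / 2 * x ^ 2 - 2 * y ^ 2 ≤ x ^ 2 - x * y := by
  nlinarith [sq_nonneg (x - y), sq_nonneg y]

lemma half_sq_sub_sub_le (x y z : ℝ) :
    1 / 2 * x ^ 2 - 2 * y ^ 2 - 2 * z ^ 2 ≤ x ^ 2 - x * y + z * (x - y) := by
  nlinarith [sq_nonneg (x - y + z), sq_nonneg y, sq_nonneg z]

namespace ProblemData

variable {d : ℕ} (P : ProblemData d)

/-- The integrand of the sum of the two equations tested with `m - φ` and `u - h`. The families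
`M, U, Φ, N` stand for the derivatives of order `2k` of `m, u, φ, h`, and `ζ` for `ξ + Δ^{2k} ξ`. -/
noncomputable def energyDensity (g : ℝ → ℝ) (ε : ℝ) {ι : Type} (s : Finset ι) (m u ζ : Rd d → ℝ)
    (Du Dh : Rd d → Rd d) (M U Φ N : ι → Rd d → ℝ) (x : Rd d) : ℝ :=
  m x * (-P.H x (Du x) + inner ℝ (P.DpH x (Du x)) (Du x)) + P.φ x * P.H x (Du x)
    + m x * g (m x) - P.φ x * g (m x) - P.V x * (m x - P.φ x) - (m x - P.φ x) * P.h x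
    - m x * inner ℝ (P.DpH x (Du x)) (Dh x)
    + ε * (m x ^ 2 - m x * P.φ x + u x ^ 2 - u x * P.h x + ζ x * (u x - P.h x)
      + ∑ i ∈ s, (M i x ^ 2 - M i x * Φ i x + (U i x ^ 2 - U i x * N i x)))

/-- Each group of terms is estimated on its own: coercivity against `m D_pH·Dh`, lower growth of `H`
weighted by `φ`, the bounded data against `m` and `|g(m)|`, and completed squares for the `ε`-terms.
-/
lemma exists_energyDensity_lower_bound {γ : ℝ} (hγ : 1 < γ) (hcoer : P.Coercive γ)
    (hlow : P.LowerGrowth γ) (hgrad : P.GradientGrowth γ) {B : ℝ} (hB : 0 ≤ B)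
    (hφ : ∀ x ∈ P.Ω, |P.φ x| ≤ B) (hV : ∀ x ∈ P.Ω, |P.V x| ≤ B) (hh : ∀ x ∈ P.Ω, |P.h x| ≤ B) :
    ∃ a K K', 0 < a ∧ 0 < K ∧ 0 ≤ K' ∧ ∀ (g : ℝ → ℝ) (ε : ℝ), 0 < ε → ε < 1 →
      ∀ {ι : Type} (s : Finset ι) (m u ζ : Rd d → ℝ) (Du Dh : Rd d → Rd d)
        (M U Φ N : ι → Rd d → ℝ), ∀ x ∈ P.Ω, 0 ≤ m x → ‖Dh x‖ ≤ B →
        m x * g (m x) + a * (m x * ‖Du x‖ ^ γ + P.φ x * ‖Du x‖ ^ γ)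
          + ε / 2 * (m x ^ 2 + u x ^ 2 + ∑ i ∈ s, (M i x ^ 2 + U i x ^ 2))
          - K * m x - K * |g (m x)| - K'
          - 2 * (P.φ x ^ 2 + P.h x ^ 2 + ζ x ^ 2 + ∑ i ∈ s, (Φ i x ^ 2 + N i x ^ 2))
        ≤ P.energyDensity g ε s m u ζ Du Dh M U Φ N x := by
  obtain ⟨C₁, hC₁, h₁⟩ := hcoer
  obtain ⟨C₂, hC₂, h₂⟩ := hlow
  obtain ⟨C₃, hC₃, h₃⟩ := hgrad
  -- Half of the coercivity constant `1 / C₁` is spent on the cross term with `Dh`; the other half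
  -- survives in `a`.
  obtain ⟨K₀, hK₀, hY⟩ := exists_mul_rpow_sub_one_le (a := 1 / (2 * C₁)) (b := C₃ * B) hγ
    (by positivity) (by positivity)
  -- `K` serves as coefficient of both `m` and `|g(m)|`, the latter needing only `B`; the `2 * B`
  -- comes from the `V` and `h` terms. The summand `1` makes the absolute-value coefficient visibly
  -- larger than `B`.
  refine ⟨min (1 / (2 * C₁)) (1 / C₂), C₁ + K₀ + C₃ * B + 2 * B + 1, C₂ * B + 2 * B ^ 2,
    by positivity, by positivity, by positivity, ?_⟩
  intro g ε hε hε1 ι s m u ζ Du Dh M U Φ N x hx hm hDh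
  set a := min (1 / (2 * C₁)) (1 / C₂)
  have ha₁ : a ≤ 1 / (2 * C₁) := min_le_left _ _
  have ha₂ : a ≤ 1 / C₂ := min_le_right _ _
  set t := ‖Du x‖ with ht
  have ht0 : 0 ≤ t := norm_nonneg _
  have htγ : 0 ≤ t ^ γ := by positivity
  have hφ0 := P.φ_nonneg x hx
  have hφB := (abs_le.1 (hφ x hx)).2
  have e₁ := h₁ x hx (Du x)
  have e₂ := h₂ x hx (Du x)
  have e₃ : inner ℝ (P.DpH x (Du x)) (Dh x) ≤ 1 / (2 * C₁) * t ^ γ + K₀ + C₃ * B := by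
    have i1 : inner ℝ (P.DpH x (Du x)) (Dh x) ≤ ‖P.DpH x (Du x)‖ * ‖Dh x‖ := real_inner_le_norm _ _
    have i2 : ‖P.DpH x (Du x)‖ * ‖Dh x‖ ≤ (C₃ * t ^ (γ - 1) + C₃) * B :=
      mul_le_mul (h₃ x hx (Du x)) hDh (norm_nonneg _) (by positivity)
    have i3 := hY t ht0
    linarith
  have f₁ : m x * (a * t ^ γ - C₁ - K₀ - C₃ * B) ≤
      m x * (-P.H x (Du x) + inner ℝ (P.DpH x (Du x)) (Du x))
        - m x * inner ℝ (P.DpH x (Du x)) (Dh x) := by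
    rw [← mul_sub]
    refine mul_le_mul_of_nonneg_left ?_ hm
    have : a * t ^ γ ≤ 1 / (2 * C₁) * t ^ γ := by gcongr
    have h2 : 1 / C₁ * t ^ γ = 1 / (2 * C₁) * t ^ γ + 1 / (2 * C₁) * t ^ γ := by
      field_simp; ring
    linarith
  have f₂ : a * (P.φ x * t ^ γ) - C₂ * B ≤ P.φ x * P.H x (Du x) := by
    have i1 : P.φ x * (a * t ^ γ - C₂) ≤ P.φ x * P.H x (Du x) := by
      refine mul_le_mul_of_nonneg_left ?_ hφ0
      have : a * t ^ γ ≤ 1 / C₂ * t ^ γ := by gcongr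
      linarith
    have i2 : P.φ x * C₂ ≤ B * C₂ := by gcongr
    linarith
  have f₃ : P.φ x * g (m x) ≤ B * |g (m x)| :=
    (mul_le_mul_of_nonneg_left (le_abs_self _) hφ0).trans (by gcongr)
  have hmφ : |m x - P.φ x| ≤ m x + B := by
    rw [abs_le]; constructor <;> linarith
  have f₄ : P.V x * (m x - P.φ x) ≤ B * (m x + B) :=
    (le_abs_self _).trans (by rw [abs_mul]; exact mul_le_mul (hV x hx) hmφ (abs_nonneg _) hB)
  have f₅ : (m x - P.φ x) * P.h x ≤ B * (m x + B) :=
    (le_abs_self _).trans (by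
      rw [abs_mul, mul_comm]; exact mul_le_mul (hh x hx) hmφ (abs_nonneg _) hB)
  have f₆ : 1 / 2 * (m x ^ 2 + u x ^ 2 + ∑ i ∈ s, (M i x ^ 2 + U i x ^ 2))
      - 2 * (P.φ x ^ 2 + P.h x ^ 2 + ζ x ^ 2 + ∑ i ∈ s, (Φ i x ^ 2 + N i x ^ 2)) ≤
      m x ^ 2 - m x * P.φ x + u x ^ 2 - u x * P.h x + ζ x * (u x - P.h x)
      + ∑ i ∈ s, (M i x ^ 2 - M i x * Φ i x + (U i x ^ 2 - U i x * N i x)) := by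
    have i1 : 1 / 2 * ∑ i ∈ s, (M i x ^ 2 + U i x ^ 2) - 2 * ∑ i ∈ s, (Φ i x ^ 2 + N i x ^ 2) ≤
        ∑ i ∈ s, (M i x ^ 2 - M i x * Φ i x + (U i x ^ 2 - U i x * N i x)) := by
      rw [Finset.mul_sum, Finset.mul_sum, ← Finset.sum_sub_distrib]
      refine Finset.sum_le_sum fun i _ => ?_
      linarith [half_sq_sub_le (M i x) (Φ i x), half_sq_sub_le (U i x) (N i x)]
    linarith [half_sq_sub_le (m x) (P.φ x), half_sq_sub_sub_le (u x) (P.h x) (ζ x)]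
  set R := P.φ x ^ 2 + P.h x ^ 2 + ζ x ^ 2 + ∑ i ∈ s, (Φ i x ^ 2 + N i x ^ 2) with hR
  have hR0 : 0 ≤ R := by
    have : 0 ≤ ∑ i ∈ s, (Φ i x ^ 2 + N i x ^ 2) := Finset.sum_nonneg fun i _ => by positivity
    positivity
  have f₇ := mul_le_mul_of_nonneg_left f₆ hε.le
  -- Here `ε < 1` makes the contribution of the data independent of `ε`.
  have f₈ : ε * R ≤ R := mul_le_of_le_one_left hR0 hε1.le
  have f₉ : 0 ≤ (C₁ + K₀ + C₃ * B + B + 1) * |g (m x)| := by positivity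
  unfold energyDensity
  linarith

/-- `C` bounds the energy of all `m, u` whose energy density has a nonpositive integral; the data
and their derivatives enter through the bounds `B` and `Q` only. -/
def EnergyBound (γ : ℝ) (Cδ : ℝ → ℝ) (B Q C : ℝ) : Prop :=
  ∀ (g : ℝ → ℝ), P.CouplingGrowth g Cδ → ∀ ε : ℝ, 0 < ε → ε < 1 →
    ∀ {ι : Type} (s : Finset ι) (m u ζ : Rd d → ℝ) (Du Dh : Rd d → Rd d)
      (M U Φ N : ι → Rd d → ℝ),
    (∀ᵐ x ∂volume.restrict P.Ω, 0 ≤ m x) → (∀ᵐ x ∂volume.restrict P.Ω, ‖Dh x‖ ≤ B) →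
    IntegrableOn m P.Ω → IntegrableOn (fun x => g (m x)) P.Ω →
    IntegrableOn (fun x => m x * g (m x)) P.Ω →
    IntegrableOn (fun x => m x * ‖Du x‖ ^ γ) P.Ω →
    IntegrableOn (fun x => P.φ x * ‖Du x‖ ^ γ) P.Ω →
    IntegrableOn (fun x => m x ^ 2 + u x ^ 2 + ∑ i ∈ s, (M i x ^ 2 + U i x ^ 2)) P.Ω →
    IntegrableOn (fun x => P.φ x ^ 2 + P.h x ^ 2 + ζ x ^ 2
      + ∑ i ∈ s, (Φ i x ^ 2 + N i x ^ 2)) P.Ω →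
    (∫ x in P.Ω, (P.φ x ^ 2 + P.h x ^ 2 + ζ x ^ 2 + ∑ i ∈ s, (Φ i x ^ 2 + N i x ^ 2))) ≤ Q →
    IntegrableOn (P.energyDensity g ε s m u ζ Du Dh M U Φ N) P.Ω →
    (∫ x in P.Ω, P.energyDensity g ε s m u ζ Du Dh M U Φ N x) ≤ 0 →
    (∫ x in P.Ω, (m x * g (m x) + 1 / C * (m x * ‖Du x‖ ^ γ)
      + 1 / C * (P.φ x * ‖Du x‖ ^ γ)))
    + ε * (∫ x in P.Ω, (m x ^ 2 + u x ^ 2 + ∑ i ∈ s, (M i x ^ 2 + U i x ^ 2))) ≤ C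

/-- Integrate the pointwise bound and absorb `∫ m` and `∫ |g(m)|` into `∫ m g(m)`. All constants are
fixed before `g`, `ε` and the solution are introduced. -/
theorem exists_energy_bound {γ : ℝ} (hγ : 1 < γ) (hcoer : P.Coercive γ)
    (hlow : P.LowerGrowth γ) (hgrad : P.GradientGrowth γ) (Cδ : ℝ → ℝ) {B : ℝ} (hB : 0 ≤ B)
    (hφ : ∀ x ∈ P.Ω, |P.φ x| ≤ B) (hV : ∀ x ∈ P.Ω, |P.V x| ≤ B) (hh : ∀ x ∈ P.Ω, |P.h x| ≤ B)
    (Q : ℝ) :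
    ∃ C, 0 < C ∧ P.EnergyBound γ Cδ B Q C := by
  obtain ⟨a, K, K', ha, hK, hK', hlb⟩ :=
    P.exists_energyDensity_lower_bound hγ hcoer hlow hgrad hB hφ hV hh
  -- With this choice the two bad terms cost a quarter of `∫ m g(m)` each, and half of it remains.
  set δ := 1 / (4 * K) with hδ
  have hδ0 : 0 < δ := by positivity
  -- The factor `2` restores the full `∫ m g(m)` and turns `ε / 2` into `ε` and `a` into `2 * a`;
  -- the latter explains `1 / (2 * a)` in the maximum.
  set C' := 2 * (2 * K * Cδ δ + K' * volume.real P.Ω + 2 * Q) with hC'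
  refine ⟨max C' (max (1 / (2 * a)) 1), by positivity, ?_⟩
  set C := max C' (max (1 / (2 * a)) 1)
  intro g hg ε hε hε1 ι s m u ζ Du Dh M U Φ N hm hDh im ig img iDu iφ isq iR hQ iE hE
  obtain ⟨ρ, hρ⟩ := P.smoothBoundary
  have hmeas : MeasurableSet P.Ω := hρ.isOpen.measurableSet
  have : IsFiniteMeasure (volume.restrict P.Ω) := ⟨by simpa using P.bounded.measure_lt_top⟩
  have hmax := (hg.2 δ hδ0).2 m im hm img
  have hg1 := (le_max_left _ _).trans hmax
  have hm1 := (le_max_right _ _).trans hmax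
  have iDu' : IntegrableOn (fun x => m x * ‖Du x‖ ^ γ + P.φ x * ‖Du x‖ ^ γ) P.Ω := iDu.add iφ
  have j₁ := img.add (iDu'.const_mul a)
  have j₂ := j₁.add (isq.const_mul (ε / 2))
  have j₃ := j₂.sub (im.const_mul K)
  have j₄ := j₃.sub (ig.abs.const_mul K)
  have j₅ := j₄.sub (integrable_const (μ := volume.restrict P.Ω) K')
  have j₆ := j₅.sub (iR.const_mul 2)
  have hint := integral_mono_ae j₆ iE (by
    filter_upwards [hm, hDh, ae_restrict_mem hmeas] with x h1 h2 h3
    exact hlb g ε hε hε1 s m u ζ Du Dh M U Φ N x h3 h1 h2)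
  rw [integral_sub' j₅ (iR.const_mul 2), integral_sub' j₄ (integrable_const _),
    integral_sub' j₃ (ig.abs.const_mul K), integral_sub' j₂ (im.const_mul K),
    integral_add' j₁ (isq.const_mul (ε / 2)), integral_add' img (iDu'.const_mul a)] at hint
  simp only [integral_const_mul, integral_const, smul_eq_mul, measureReal_restrict_apply_univ]
    at hint
  have hKδ : K * δ = 1 / 4 := by rw [hδ]; field_simp
  have k₁ : K * ∫ x in P.Ω, m x ≤ 1 / 4 * (∫ x in P.Ω, m x * g (m x)) + K * Cδ δ := by
    have := mul_le_mul_of_nonneg_left hm1 hK.le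
    rw [mul_add, ← mul_assoc, hKδ] at this
    exact this
  have k₂ : K * ∫ x in P.Ω, |g (m x)| ≤ 1 / 4 * (∫ x in P.Ω, m x * g (m x)) + K * Cδ δ := by
    have := mul_le_mul_of_nonneg_left hg1 hK.le
    rw [mul_add, ← mul_assoc, hKδ] at this
    exact this
  have hDu0 : 0 ≤ ∫ x in P.Ω, (m x * ‖Du x‖ ^ γ + P.φ x * ‖Du x‖ ^ γ) := by
    refine integral_nonneg_of_ae ?_
    filter_upwards [hm, ae_restrict_mem hmeas] with x h1 h3
    have := P.φ_nonneg x h3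
    simp only [Pi.zero_apply]
    positivity
  have hC1 : 1 / C ≤ 2 * a := by
    rw [div_le_iff₀ (by positivity)]
    have h1 : 1 / (2 * a) ≤ C := (le_max_left _ _).trans (le_max_right _ _)
    rwa [div_le_iff₀' (by positivity)] at h1
  have hsplit : ∫ x in P.Ω, (m x * g (m x) + 1 / C * (m x * ‖Du x‖ ^ γ)
        + 1 / C * (P.φ x * ‖Du x‖ ^ γ)) = (∫ x in P.Ω, m x * g (m x))
        + 1 / C * ∫ x in P.Ω, (m x * ‖Du x‖ ^ γ + P.φ x * ‖Du x‖ ^ γ) := by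
    rw [← integral_const_mul, ← integral_add img (iDu'.const_mul _)]
    congr 1
    ext x
    ring
  rw [hsplit]
  have h2 := mul_le_mul_of_nonneg_right hC1 hDu0
  have h3 : C' ≤ C := le_max_left _ _
  linarith

end ProblemData

/-! ### Words versus multi-indices, and regularity of the data -/

section Words

variable {d : ℕ}

lemma mem_multiIndices {n : ℕ} {α : Fin d → ℕ} : α ∈ multiIndices d n ↔ ∑ i, α i = n := by
  simp [multiIndices]

/-- Group the words by their letter counts: each multi-index of order `n` is the count of at least
one word, namely `wordOf α`, and the remaining squares are nonnegative. -/
lemma sum_multiIndices_sq_le (S : Set (Rd d)) (n : ℕ) (f : Rd d → ℝ) (x : Rd d) :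
    ∑ α ∈ multiIndices d n, mpd S α f x ^ 2 ≤
      ∑ w : Fin n → Fin d, pdl S (List.ofFn w) f x ^ 2 := by
  have hmaps : ∀ w ∈ (Finset.univ : Finset (Fin n → Fin d)),
      (fun i => (List.ofFn w).count i) ∈ multiIndices d n := fun w _ => by
    rw [mem_multiIndices, sum_count, List.length_ofFn]
  rw [← Finset.sum_fiberwise_of_maps_to hmaps]
  refine Finset.sum_le_sum fun α hα => ?_
  have hlen : (wordOf α).length = n := by rw [length_wordOf]; exact mem_multiIndices.1 hα
  obtain ⟨w, hw⟩ : ∃ w : Fin n → Fin d, List.ofFn w = wordOf α := by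
    subst hlen
    exact ⟨(wordOf α).get, List.ofFn_get _⟩
  have hmem : w ∈ Finset.univ.filter fun w : Fin n → Fin d =>
      (fun i => (List.ofFn w).count i) = α := by
    simp only [Finset.mem_filter, Finset.mem_univ, true_and, hw]
    ext i
    exact count_wordOf α i
  rw [mpd_eq_pdl, ← hw]
  exact Finset.single_le_sum (f := fun w : Fin n → Fin d => pdl S (List.ofFn w) f x ^ 2)
    (fun _ _ => sq_nonneg _) hmem

end Words

lemma contDiffOn_gradOf {d : ℕ} {S : Set (Rd d)} (hS : IsRegularSet S) {n : ℕ} {f : Rd d → ℝ}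
    (hf : ContDiffOn ℝ (n + 1 : ℕ) f S) : ContDiffOn ℝ n (gradOf (mpd S) f) S := by
  rw [contDiffOn_euclidean]
  intro i
  simp only [gradOf, mpd_single]
  exact contDiffOn_pd hS hf

namespace ProblemData

variable {d : ℕ} (P : ProblemData d)

lemma isOpen : IsOpen P.Ω := P.smoothBoundary.choose_spec.isOpen

lemma measurableSet : MeasurableSet P.Ω := P.isOpen.measurableSet

lemma isRegularSet_closure : IsRegularSet (closure P.Ω) :=
  P.smoothBoundary.choose_spec.isRegularSet_closure

lemma isFiniteMeasure : IsFiniteMeasure (volume.restrict P.Ω) :=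
  ⟨by simpa using P.bounded.measure_lt_top⟩

lemma integrableOn {f : Rd d → ℝ} (hf : ContinuousOn f (closure P.Ω)) : IntegrableOn f P.Ω :=
  integrableOn_of_continuousOn_closure P.bounded hf

/-- `H` is jointly smooth only on `closure Ω × ℝ^d`. The chain rule along `q ↦ (x, q)`, which stays
in that set, turns the partial gradient into a joint derivative, from which the joint smoothness of
`D_pH` follows. -/
lemma DpH_apply_eq {x : Rd d} (hx : x ∈ closure P.Ω) (p : Rd d) (i : Fin d) :
    P.DpH x p i = fderivWithin ℝ (fun z : Rd d × Rd d => P.H z.1 z.2) (closure P.Ω ×ˢ univ) (x, p)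
      (0, EuclideanSpace.single i 1) := by
  have h1 : HasFDerivWithinAt (fun z : Rd d × Rd d => P.H z.1 z.2)
      (fderivWithin ℝ (fun z : Rd d × Rd d => P.H z.1 z.2) (closure P.Ω ×ˢ univ) (x, p))
      (closure P.Ω ×ˢ univ) (x, p) :=
    (P.H_smooth.differentiableOn (by simp) (x, p) ⟨hx, mem_univ _⟩).hasFDerivWithinAt
  have h2 : HasFDerivWithinAt (fun q : Rd d => (x, q)) (ContinuousLinearMap.inr ℝ (Rd d) (Rd d))
      univ p := (hasFDerivAt_prodMk_right x p).hasFDerivWithinAt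
  have h3 := h1.comp p h2 fun q _ => ⟨hx, mem_univ _⟩
  have h4 : fderiv ℝ (P.H x) p = _ := (hasFDerivWithinAt_univ.1 h3).fderiv
  rw [DpH, gradient_apply_eq, h4]
  simp

lemma contDiffOn_DpH_apply (i : Fin d) :
    ContDiffOn ℝ ∞ (fun z : Rd d × Rd d => P.DpH z.1 z.2 i) (closure P.Ω ×ˢ univ) := by
  have h1 : ContDiffOn ℝ ∞ (fun z => fderivWithin ℝ (fun z : Rd d × Rd d => P.H z.1 z.2)
      (closure P.Ω ×ˢ univ) z (0, EuclideanSpace.single i 1)) (closure P.Ω ×ˢ univ) :=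
    (P.H_smooth.fderivWithin
      (P.isRegularSet_closure.uniqueDiffOn.prod uniqueDiffOn_univ) (by simp)).clm_apply
      contDiffOn_const
  exact h1.congr fun z hz => P.DpH_apply_eq hz.1 z.2 i

lemma inner_DpH_eq (x p q : Rd d) : inner ℝ (P.DpH x p) q = ∑ i, P.DpH x p i * q i := by
  rw [PiLp.inner_apply]
  simp [mul_comm]

lemma exists_data_bound : ∃ B, 0 ≤ B ∧ ∀ x ∈ closure P.Ω, |P.φ x| ≤ B ∧ |P.V x| ≤ B ∧ |P.h x| ≤ B ∧
    ‖gradOf (mpd (closure P.Ω)) P.h x‖ ≤ B := by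
  have hc := P.bounded.isCompact_closure
  obtain ⟨B₁, h₁⟩ := hc.exists_bound_of_continuousOn P.φ_smooth.continuousOn
  obtain ⟨B₂, h₂⟩ := hc.exists_bound_of_continuousOn P.V_smooth.continuousOn
  obtain ⟨B₃, h₃⟩ := hc.exists_bound_of_continuousOn P.h_smooth.continuousOn
  obtain ⟨B₄, h₄⟩ := hc.exists_bound_of_continuousOn
    (contDiffOn_gradOf (n := 0) P.isRegularSet_closure (P.h_smooth.of_le (by
      exact_mod_cast le_top))).continuousOn
  refine ⟨max 0 (max (max B₁ B₂) (max B₃ B₄)), le_max_left _ _, fun x hx => ⟨?_, ?_, ?_, ?_⟩⟩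
  · exact (h₁ x hx).trans (by simp)
  · exact (h₂ x hx).trans (by simp)
  · exact (h₃ x hx).trans (by simp)
  · exact (h₄ x hx).trans (by simp)

/-! ### Classical solutions: boundary conditions, energy identity and estimate -/

variable {P} in
-- The outward normal is a nonzero multiple of `∇ρ`, and by symmetry of derivatives the condition on
-- multi-indices holds for every word. This is the form of the condition that Green's formula uses.
lemma IsClassicalSolution.boundary_normal {k : ℕ} {g : ℝ → ℝ} {ε : ℝ} {m u : Rd d → ℝ}
    (h : P.IsClassicalSolution k g ε m u) {ρ : Rd d → ℝ} (hρ : IsDefiningFunction P.Ω ρ)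
    {L : List (Fin d)} {j : ℕ} (hLj : L.length + j + 1 = 2 * k) {x : Rd d}
    (hx : x ∈ frontier P.Ω) :
    ∑ i, pd (closure P.Ω) i (pdl (closure P.Ω) L (lapPow (closure P.Ω) j m)) x * gradient ρ x i
      = 0 := by
  have hS := P.isRegularSet_closure
  have hxS : x ∈ closure P.Ω := frontier_subset_closure hx
  have hne := hρ.2.2 x (hρ.eq_zero_of_mem_frontier hx)
  have h0 := h.boundary_m (fun i => L.count i) j (by rw [sum_count]; exact hLj) x hx _
    ⟨hx, ρ, hρ, rfl⟩
  have hm : ContDiffOn ℝ (4 * k : ℕ) m (closure P.Ω) := h.m_smooth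
  have hreg : ContDiffOn ℝ L.length (lapPow (closure P.Ω) j m) (closure P.Ω) :=
    contDiffOn_lapPow hS j (contDiffOn_of_nat_le (by omega) hm)
  rw [← fderivWithin_congr (pdl_eqOn_mpd hS L hreg) (pdl_eqOn_mpd hS L hreg hxS)] at h0
  set F := pdl (closure P.Ω) L (lapPow (closure P.Ω) j m) with hF
  rw [map_smul, smul_eq_mul, mul_eq_zero, inv_eq_zero, norm_eq_zero] at h0
  have h1 := h0.resolve_left hne
  have h2 : gradient ρ x = ∑ i, gradient ρ x i • EuclideanSpace.single i (1 : ℝ) := by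
    ext l
    simp [Pi.single_apply]
  rw [h2, map_sum] at h1
  rw [← h1]
  refine Finset.sum_congr rfl fun i _ => ?_
  rw [map_smul, smul_eq_mul, mul_comm]
  rfl

variable {P} in
lemma IsClassicalSolution.boundary_dirichlet {k : ℕ} {g : ℝ → ℝ} {ε : ℝ} {m u : Rd d → ℝ}
    (h : P.IsClassicalSolution k g ε m u) {L : List (Fin d)} (hL : L.length + 1 ≤ 2 * k) {x : Rd d}
    (hx : x ∈ frontier P.Ω) : pdl (closure P.Ω) L (fun y => u y - P.h y) x = 0 := by
  have hS := P.isRegularSet_closure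
  have hxS : x ∈ closure P.Ω := frontier_subset_closure hx
  have hu : ContDiffOn ℝ (4 * k : ℕ) u (closure P.Ω) := h.u_smooth
  have hu' : ContDiffOn ℝ L.length u (closure P.Ω) := contDiffOn_of_nat_le (by omega) hu
  have hh : ContDiffOn ℝ L.length P.h (closure P.Ω) := P.h_smooth.of_le (by
    exact_mod_cast le_top)
  refine (pdl_sub hS L hu' hh hxS).trans ?_
  dsimp only
  rw [pdl_eqOn_mpd hS L hu' hxS, pdl_eqOn_mpd hS L hh hxS,
    h.boundary_u _ (by rw [sum_count]; exact hL) x hx, sub_self]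

variable {P} in
/-- The classical solution satisfies the energy identity. -/
lemma IsClassicalSolution.integral_energyDensity {k : ℕ} (hk : 1 ≤ k) {g : ℝ → ℝ} {ε : ℝ} {m u : Rd d → ℝ}
    (h : P.IsClassicalSolution k g ε m u) :
    let S := closure P.Ω
    let W := P.energyDensity g ε (Finset.univ : Finset (Fin (2 * k) → Fin d)) m u
      (fun x => P.ξ x + lapPow S (2 * k) P.ξ x) (gradOf (mpd S) u) (gradOf (mpd S) P.h)
      (fun w => pdl S (List.ofFn w) m) (fun w => pdl S (List.ofFn w) u)
      (fun w => pdl S (List.ofFn w) P.φ) (fun w => pdl S (List.ofFn w) P.h)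
    IntegrableOn W P.Ω ∧ ∫ x in P.Ω, W x = 0 := by
  intro S W
  obtain ⟨ρ, hρ⟩ := P.smoothBoundary
  have hS : IsRegularSet S := P.isRegularSet_closure
  have hm : ContDiffOn ℝ (4 * k : ℕ) m S := h.m_smooth
  have hu : ContDiffOn ℝ (4 * k : ℕ) u S := h.u_smooth
  have hfin : ∀ {f : Rd d → ℝ} (n : ℕ), ContDiffOn ℝ ∞ f S → ContDiffOn ℝ n f S := fun n hf =>
    hf.of_le (by exact_mod_cast le_top)
  have hle : ∀ {f : Rd d → ℝ} (n : ℕ), n ≤ 4 * k → ContDiffOn ℝ (4 * k : ℕ) f S →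
    ContDiffOn ℝ n f S := fun n hn hf => contDiffOn_of_nat_le hn hf
  set v : Rd d → ℝ := fun y => u y - P.h y with hv
  have hvS : ContDiffOn ℝ (4 * k : ℕ) v S := hu.sub (hfin _ P.h_smooth)
  set w : Rd d → ℝ := fun y => m y - P.φ y with hw
  have hwS : ContDiffOn ℝ (4 * k : ℕ) w S := hm.sub (hfin _ P.φ_smooth)
  set Du := gradOf (mpd S) u with hDu
  have hDuS : ContDiffOn ℝ 1 Du S := by
    simpa using contDiffOn_gradOf (n := 1) hS (hle 2 (by omega) hu)
  have hpair : MapsTo (fun y => (y, Du y)) S (S ×ˢ univ) := fun y hy => ⟨hy, mem_univ _⟩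
  set F : Fin d → Rd d → ℝ := fun i y => m y * P.DpH y (Du y) i with hF
  have hFS : ∀ i, ContDiffOn ℝ 1 (F i) S := fun i =>
    (hle 1 (by omega) hm |>.of_le (by simp)).mul
      (((P.contDiffOn_DpH_apply i).of_le (by exact_mod_cast le_top)).comp
        (contDiffOn_id.prodMk hDuS) hpair)
  have hv1 : ContDiffOn ℝ 1 v S := by simpa using hle 1 (by omega) hvS
  -- the three integrations by parts
  have hT1 : ∀ i, ∫ x in P.Ω, (F i x * pd S i v x + pd S i (F i) x * v x) = 0 := by
    intro i
    rw [integral_add, hρ.integral_mul_pd P.bounded (hFS i) hv1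
      (fun x hx => h.boundary_dirichlet (L := []) (by simp; omega) hx), neg_add_cancel]
    · exact P.integrableOn ((hFS i).continuousOn.mul
        (contDiffOn_pd (n := 0) hS (by simpa using hv1)).continuousOn)
    · exact P.integrableOn ((contDiffOn_pd (n := 0) hS (by simpa using hFS i)).continuousOn.mul
        hv1.continuousOn)
  have hwords : ∀ {f : Rd d → ℝ} (s : Fin (2 * k) → Fin d), ContDiffOn ℝ (4 * k : ℕ) f S →
      ContinuousOn (pdl S (List.ofFn s) f) S := fun s hf =>
    (contDiffOn_pdl (n := 0) hS _ (hle _ (by simp; omega) hf)).continuousOn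
  have hlap : ∀ {f : Rd d → ℝ}, ContDiffOn ℝ (4 * k : ℕ) f S →
      ContinuousOn (lapPow S (2 * k) f) S := fun hf =>
    (contDiffOn_lapPow (n := 0) hS _ (hle _ (by omega) hf)).continuousOn
  have hgreen : ∀ {f z : Rd d → ℝ}, ContDiffOn ℝ (4 * k : ℕ) f S → ContDiffOn ℝ (4 * k : ℕ) z S →
      (∀ (L : List (Fin d)) (j : ℕ), L.length + j + 1 = 2 * k → ∀ x ∈ frontier P.Ω,
        (∑ i, pd S i (pdl S L (lapPow S j f)) x * gradient ρ x i = 0) ∨ pdl S L z x = 0) →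
      ∫ x in P.Ω, ((∑ s : Fin (2 * k) → Fin d, pdl S (List.ofFn s) f x * pdl S (List.ofFn s) z x)
        - lapPow S (2 * k) f x * z x) = 0 := by
    intro f z hf hz hbd
    have hi : ∀ s : Fin (2 * k) → Fin d,
        IntegrableOn (fun x => pdl S (List.ofFn s) f x * pdl S (List.ofFn s) z x) P.Ω := fun s =>
      P.integrableOn ((hwords s hf).mul (hwords s hz))
    have hl : IntegrableOn (fun x => lapPow S (2 * k) f x * z x) P.Ω :=
      P.integrableOn ((hlap hf).mul hz.continuousOn)
    rw [integral_sub (integrable_finsetSum _ fun s _ => hi s) hl, integral_finsetSum _ fun s _ => hi s,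
      hρ.integral_lapPow_mul P.bounded (2 * k) (hle _ (by omega) hf) (hle _ (by omega) hz) hbd]
    simp only [even_two, Even.mul_right, Even.neg_pow, one_pow, one_mul]
    exact sub_self _
  -- For `m` the normal conditions remove the boundary terms, although `m - φ` need not vanish
  -- there; for `u` the Dirichlet conditions remove them through `u - h`.
  have hT2 := hgreen hm hwS fun L j hLj x hx => Or.inl (h.boundary_normal hρ hLj hx)
  have hT3 := hgreen hu hvS fun L j hLj x hx => Or.inr (h.boundary_dirichlet (by omega) hx)
  have hpdv : ∀ i x, x ∈ S → pd S i v x = Du x i - gradOf (mpd S) P.h x i := by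
    intro i x hx
    simp only [hDu, gradOf, mpd_single]
    exact pd_sub hS (hu.differentiableOn (by norm_cast; omega))
      (P.h_smooth.differentiableOn (by simp)) hx
  have hsubw : ∀ {a b : Rd d → ℝ} (s : Fin (2 * k) → Fin d) (x : Rd d), x ∈ S →
      ContDiffOn ℝ (4 * k : ℕ) a S → ContDiffOn ℝ ∞ b S →
      pdl S (List.ofFn s) (fun y => a y - b y) x =
        pdl S (List.ofFn s) a x - pdl S (List.ofFn s) b x := fun s x hx ha hb =>
    pdl_sub hS _ (hle _ (by simp; omega) ha) (hfin _ hb) hx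
  -- Modulo `m - φ` times the first equation and `u - h` times the second, the density is a sum of
  -- three expressions whose integrals vanish.
  have hWeq : ∀ x ∈ P.Ω, W x = (∑ i, (F i x * pd S i v x + pd S i (F i) x * v x))
      + ε * ((∑ s : Fin (2 * k) → Fin d, pdl S (List.ofFn s) m x * pdl S (List.ofFn s) w x)
        - lapPow S (2 * k) m x * w x)
      + ε * ((∑ s : Fin (2 * k) → Fin d, pdl S (List.ofFn s) u x * pdl S (List.ofFn s) v x)
        - lapPow S (2 * k) u x * v x) := by
    intro x hx
    have hxS : x ∈ S := subset_closure hx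
    have e1 := h.hamiltonJacobi x hx
    have e2 := h.transport x hx
    rw [lapPow_add hS (2 * k) (hle _ (by omega) hu) (hfin _ P.ξ_smooth) hxS] at e2
    have s1 : ∑ i, (F i x * pd S i v x + pd S i (F i) x * v x) =
        m x * (inner ℝ (P.DpH x (Du x)) (Du x))
          - m x * inner ℝ (P.DpH x (Du x)) (gradOf (mpd S) P.h x)
          + (∑ i, pd S i (F i) x) * v x := by
      rw [Finset.sum_add_distrib, Finset.sum_mul, inner_DpH_eq, inner_DpH_eq, Finset.mul_sum,
        Finset.mul_sum, ← Finset.sum_sub_distrib]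
      congr 1
      refine Finset.sum_congr rfl fun i _ => ?_
      rw [hpdv i x hxS]
      ring
    have s2 : ∑ s : Fin (2 * k) → Fin d, (pdl S (List.ofFn s) m x ^ 2
          - pdl S (List.ofFn s) m x * pdl S (List.ofFn s) P.φ x
          + (pdl S (List.ofFn s) u x ^ 2 - pdl S (List.ofFn s) u x * pdl S (List.ofFn s) P.h x)) =
        (∑ s : Fin (2 * k) → Fin d, pdl S (List.ofFn s) m x * pdl S (List.ofFn s) w x)
        + ∑ s : Fin (2 * k) → Fin d, pdl S (List.ofFn s) u x * pdl S (List.ofFn s) v x := by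
      rw [← Finset.sum_add_distrib]
      refine Finset.sum_congr rfl fun s _ => ?_
      rw [hsubw s x hxS hm P.φ_smooth, hsubw s x hxS hu P.h_smooth]
      ring
    change P.energyDensity g ε _ m u _ _ _ _ _ _ _ x = _
    unfold energyDensity
    rw [s1, s2]
    simp only [hv, hw]
    linear_combination (m x - P.φ x) * e1 + (u x - P.h x) * e2
  have hI1 : IntegrableOn (fun x => ∑ i, (F i x * pd S i v x + pd S i (F i) x * v x)) P.Ω := by
    refine P.integrableOn (continuousOn_finsetSum _ fun i _ => ?_)
    exact ((hFS i).continuousOn.mul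
        (contDiffOn_pd (n := 0) hS (by simpa using hv1)).continuousOn).add
      ((contDiffOn_pd (n := 0) hS (by simpa using hFS i)).continuousOn.mul hv1.continuousOn)
  have hI2 : ∀ {f z : Rd d → ℝ}, ContDiffOn ℝ (4 * k : ℕ) f S → ContDiffOn ℝ (4 * k : ℕ) z S →
      IntegrableOn (fun x => ε * ((∑ s : Fin (2 * k) → Fin d,
        pdl S (List.ofFn s) f x * pdl S (List.ofFn s) z x)
        - lapPow S (2 * k) f x * z x)) P.Ω := fun hf hz =>
    P.integrableOn (continuousOn_const.mul ((continuousOn_finsetSum _ fun s _ =>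
      (hwords s hf).mul (hwords s hz)).sub ((hlap hf).mul hz.continuousOn)))
  have hI12 : IntegrableOn (fun x => (∑ i, (F i x * pd S i v x + pd S i (F i) x * v x))
      + ε * ((∑ s : Fin (2 * k) → Fin d, pdl S (List.ofFn s) m x * pdl S (List.ofFn s) w x)
        - lapPow S (2 * k) m x * w x)) P.Ω := hI1.add (hI2 hm hwS)
  refine ⟨(hI12.add (hI2 hu hvS)).congr_fun (fun x hx => (hWeq x hx).symm) P.measurableSet, ?_⟩
  rw [setIntegral_congr_fun P.measurableSet hWeq, integral_add hI12 (hI2 hu hvS),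
    integral_add hI1 (hI2 hm hwS), integral_const_mul, integral_const_mul, hT2, hT3,
    integral_finsetSum]
  · simp [hT1]
  · exact fun i _ => P.integrableOn (((hFS i).continuousOn.mul
        (contDiffOn_pd (n := 0) hS (by simpa using hv1)).continuousOn).add
      ((contDiffOn_pd (n := 0) hS (by simpa using hFS i)).continuousOn.mul hv1.continuousOn))

end ProblemData

namespace ProblemData

variable {d : ℕ} {P : ProblemData d}

lemma IsClassicalSolution.aprioriEstimate {k : ℕ} (hk : 1 ≤ k) {γ : ℝ} (hγ : 1 < γ)
    {g : ℝ → ℝ} (hg : ContDiffOn ℝ ∞ g (Ici 0)) {Cδ : ℝ → ℝ} (hgC : P.CouplingGrowth g Cδ)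
    {ε : ℝ} (hε : 0 < ε) (hε1 : ε < 1) {m u : Rd d → ℝ} (h : P.IsClassicalSolution k g ε m u)
    {B Q C : ℝ} (hC : P.EnergyBound γ Cδ B Q C)
    (hB : ∀ x ∈ closure P.Ω, ‖gradOf (mpd (closure P.Ω)) P.h x‖ ≤ B)
    (hQ : (∫ x in P.Ω, (P.φ x ^ 2 + P.h x ^ 2 + (P.ξ x + lapPow (closure P.Ω) (2 * k) P.ξ x) ^ 2
      + ∑ w : Fin (2 * k) → Fin d, (pdl (closure P.Ω) (List.ofFn w) P.φ x ^ 2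
        + pdl (closure P.Ω) (List.ofFn w) P.h x ^ 2))) ≤ Q) :
    P.AprioriEstimate γ k g ε C (mpd (closure P.Ω)) m u := by
  set S := closure P.Ω with hSdef
  have hS : IsRegularSet S := P.isRegularSet_closure
  have hm : ContDiffOn ℝ (4 * k : ℕ) m S := h.m_smooth
  have hu : ContDiffOn ℝ (4 * k : ℕ) u S := h.u_smooth
  have hfin : ∀ {f : Rd d → ℝ} (n : ℕ), ContDiffOn ℝ ∞ f S → ContDiffOn ℝ n f S := fun n hf =>
    hf.of_le (by exact_mod_cast le_top)
  have hmc : ContinuousOn m S := hm.continuousOn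
  -- Nonnegativity passes to the boundary by continuity; it is needed there because `g` is regular
  -- on `[0, ∞)` only.
  have hm0 : ∀ x ∈ S, 0 ≤ m x := by
    have hcl : IsClosed (S ∩ m ⁻¹' Ici 0) :=
      hmc.preimage_isClosed_of_isClosed isClosed_closure isClosed_Ici
    have hsub : P.Ω ⊆ S ∩ m ⁻¹' Ici 0 := fun y hy => ⟨subset_closure hy, h.m_nonneg y hy⟩
    exact fun x hx => (closure_minimal hsub hcl hx).2
  have hgm : ContinuousOn (fun x => g (m x)) S := hg.continuousOn.comp hmc hm0
  have hDu : ContinuousOn (fun x => ‖gradOf (mpd S) u x‖ ^ γ) S :=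
    (contDiffOn_gradOf (n := 0) hS (contDiffOn_of_nat_le (by omega) hu)).continuousOn.norm.rpow_const
      fun x _ => Or.inr (by linarith)
  have hpdl : ∀ {f : Rd d → ℝ} (L : List (Fin d)), L.length ≤ 4 * k →
      ContDiffOn ℝ (4 * k : ℕ) f S → ContinuousOn (pdl S L f) S := fun L hL hf =>
    (contDiffOn_pdl (n := 0) hS L (contDiffOn_of_nat_le (by omega) hf)).continuousOn
  have isq : IntegrableOn (fun x => m x ^ 2 + u x ^ 2 + ∑ w : Fin (2 * k) → Fin d,
      (pdl S (List.ofFn w) m x ^ 2 + pdl S (List.ofFn w) u x ^ 2)) P.Ω :=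
    P.integrableOn (((hmc.pow 2).add (hu.continuousOn.pow 2)).add
      (continuousOn_finsetSum _ fun w _ => ((hpdl _ (by simp; omega) hm).pow 2).add
        ((hpdl _ (by simp; omega) hu).pow 2)))
  have isq' : IntegrableOn (fun x => m x ^ 2 + u x ^ 2 + ∑ α ∈ multiIndices d (2 * k),
      (mpd S α m x ^ 2 + mpd S α u x ^ 2)) P.Ω := by
    refine P.integrableOn (((hmc.pow 2).add (hu.continuousOn.pow 2)).add
      (continuousOn_finsetSum _ fun α hα => ?_))
    rw [mem_multiIndices] at hα
    rw [mpd_eq_pdl, mpd_eq_pdl]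
    exact ((hpdl _ (by rw [length_wordOf]; omega) hm).pow 2).add
        ((hpdl _ (by rw [length_wordOf]; omega) hu).pow 2)
  have img : IntegrableOn (fun x => m x * g (m x)) P.Ω := P.integrableOn (hmc.mul hgm)
  have imD : IntegrableOn (fun x => m x * ‖gradOf (mpd S) u x‖ ^ γ) P.Ω :=
    P.integrableOn (hmc.mul hDu)
  have iφD : IntegrableOn (fun x => P.φ x * ‖gradOf (mpd S) u x‖ ^ γ) P.Ω :=
    P.integrableOn (P.φ_smooth.continuousOn.mul hDu)
  have hpdl' : ∀ {f : Rd d → ℝ} (L : List (Fin d)), ContDiffOn ℝ ∞ f S →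
      ContinuousOn (pdl S L f) S := fun L hf => (contDiffOn_infty_pdl hS hf L).continuousOn
  have hW := h.integral_energyDensity hk
  have key := hC g hgC ε hε hε1 (Finset.univ : Finset (Fin (2 * k) → Fin d)) m u
    (fun x => P.ξ x + lapPow S (2 * k) P.ξ x) (gradOf (mpd S) u) (gradOf (mpd S) P.h)
    (fun w => pdl S (List.ofFn w) m) (fun w => pdl S (List.ofFn w) u)
    (fun w => pdl S (List.ofFn w) P.φ) (fun w => pdl S (List.ofFn w) P.h)
    ((ae_restrict_iff' P.measurableSet).2 (Eventually.of_forall h.m_nonneg))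
    ((ae_restrict_iff' P.measurableSet).2
      (Eventually.of_forall fun x hx => hB x (subset_closure hx)))
    (P.integrableOn hmc) (P.integrableOn hgm) img imD iφD isq
    (P.integrableOn ((((P.φ_smooth.continuousOn.pow 2).add (P.h_smooth.continuousOn.pow 2)).add
      ((P.ξ_smooth.continuousOn.add (contDiffOn_lapPow (n := 0) hS _
        (hfin _ P.ξ_smooth)).continuousOn).pow 2)).add
      (continuousOn_finsetSum _ fun w _ => ((hpdl' _ P.φ_smooth).pow 2).add
        ((hpdl' _ P.h_smooth).pow 2)))) hQ hW.1 hW.2.le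
  refine ⟨img, imD, iφD, isq', le_trans ?_ key⟩
  refine add_le_add le_rfl (mul_le_mul_of_nonneg_left ?_ hε.le)
  refine integral_mono isq' isq fun x => ?_
  simp only [Finset.sum_add_distrib]
  gcongr
  · exact sum_multiIndices_sq_le S (2 * k) m x
  · exact sum_multiIndices_sq_le S (2 * k) u x

end ProblemData

/-! ### Weak derivatives and their agreement with classical ones -/

section Weak

variable {d : ℕ} {Ω : Set (Rd d)} {α : Fin d → ℕ} {f g f' g' η : Rd d → ℝ}

lemma pd_univ_apply (i : Fin d) (f : Rd d → ℝ) (x : Rd d) :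
    pd univ i f x = fderiv ℝ f x (EuclideanSpace.single i 1) := by
  rw [pd, fderivWithin_univ]

lemma IsTest.pd (h : IsTest Ω η) (i : Fin d) : IsTest Ω (pd univ i η) := by
  have hts : tsupport (MFG.pd univ i η) ⊆ tsupport η := by
    refine closure_minimal (fun x hx => support_fderiv_subset ℝ (fun h => hx ?_))
      (isClosed_tsupport _)
    simp [pd_univ_apply, h]
  refine ⟨?_, HasCompactSupport.of_support_subset_isCompact h.2.1
    ((subset_tsupport _).trans hts), hts.trans h.2.2⟩
  rw [← contDiffOn_univ]
  exact contDiffOn_infty_pd isRegularSet_univ h.1.contDiffOn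

lemma IsTest.pdl (h : IsTest Ω η) (L : List (Fin d)) : IsTest Ω (pdl univ L η) := by
  induction L with
  | nil => exact h
  | cons i L ih => exact ih.pd i

lemma IsTest.mpd (h : IsTest Ω η) (α : Fin d → ℕ) : IsTest Ω (mpd univ α η) := by
  rw [mpd_eq_pdl]; exact h.pdl _

lemma IsTest.eq_zero_of_notMem (h : IsTest Ω η) {x : Rd d} (hx : x ∉ Ω) : η x = 0 :=
  image_eq_zero_of_notMem_tsupport fun hx' => hx (h.2.2 hx')

lemma IsTest.pdl_eqOn_mpd (h : IsTest Ω η) (L : List (Fin d)) :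
    MFG.pdl univ L η = MFG.mpd univ (fun i => L.count i) η :=
  funext fun x => MFG.pdl_eqOn_mpd isRegularSet_univ L
    (h.1.contDiffOn.of_le (by exact_mod_cast le_top)) (mem_univ x)

lemma IsTest.memLp (h : IsTest Ω η) (μ : Measure (Rd d)) [IsFiniteMeasureOnCompacts μ] :
    MemLp η 2 μ :=
  h.1.continuous.memLp_of_hasCompactSupport h.2.1

lemma IsTest.integrableOn_mul (h : IsTest Ω η) (hf : LocallyIntegrableOn f Ω) : IntegrableOn (fun x => f x * η x) Ω := by
  have h1 : IntegrableOn f (tsupport η) := hf.integrableOn_compact_subset h.2.2 h.2.1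
  have h2 : IntegrableOn (fun x => f x * η x) (tsupport η) :=
    h1.mul_continuousOn h.1.continuous.continuousOn h.2.1
  have h3 : Integrable (fun x => f x * η x) := by
    refine (integrableOn_iff_integrable_of_support_subset fun x hx => ?_).1 h2
    by_contra hne
    exact hx (by simp [image_eq_zero_of_notMem_tsupport hne])
  exact h3.integrableOn

lemma IsWeakDeriv.ae_eq (hΩ : IsOpen Ω) (h : IsWeakDeriv Ω α f f') (h' : IsWeakDeriv Ω α f g') :
    f' =ᵐ[volume.restrict Ω] g' := by
  have key := hΩ.ae_eq_zero_of_integral_contDiff_smul_eq_zero (f := fun x => f' x - g' x)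
    (μ := volume) (h.2.1.sub h'.2.1) (by
      intro η h1 h2 h3
      have hη : IsTest Ω η := ⟨h1, h2, h3⟩
      have e := (h.2.2 η hη).symm.trans (h'.2.2 η hη)
      have e' := mul_left_cancel₀ (pow_ne_zero _ (by norm_num)) e
      rw [← setIntegral_eq_integral_of_forall_compl_eq_zero (s := Ω) fun x hx => by
        rw [hη.eq_zero_of_notMem hx, zero_smul]]
      simp only [smul_eq_mul, mul_comm (η _), sub_mul]
      rw [integral_sub (hη.integrableOn_mul h.2.1)
        (hη.integrableOn_mul h'.2.1), e', sub_self])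
  rw [EventuallyEq, ae_restrict_iff' hΩ.measurableSet]
  filter_upwards [key] with x hx hxΩ
  exact sub_eq_zero.1 (hx hxΩ)

lemma isWeakDeriv_weakDeriv (h : ∃ f', IsWeakDeriv Ω α f f') :
    IsWeakDeriv Ω α f (weakDeriv Ω α f) := by
  rw [weakDeriv, dif_pos h]
  exact h.choose_spec

lemma IsWeakDeriv.weakDeriv_ae_eq (hΩ : IsOpen Ω) (h : IsWeakDeriv Ω α f f') :
    weakDeriv Ω α f =ᵐ[volume.restrict Ω] f' :=
  (isWeakDeriv_weakDeriv ⟨f', h⟩).ae_eq hΩ h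

lemma isWeakDeriv_zero (hf : LocallyIntegrableOn f Ω) : IsWeakDeriv Ω 0 f f :=
  ⟨hf, hf, fun η _ => by simp [mpd_zero]⟩

lemma IsWeakDeriv.linComb (h : IsWeakDeriv Ω α f f') (h' : IsWeakDeriv Ω α g g') (a b : ℝ) :
    IsWeakDeriv Ω α (fun x => a * f x + b * g x) (fun x => a * f' x + b * g' x) := by
  refine ⟨(h.1.smul a).add (h'.1.smul b), (h.2.1.smul a).add (h'.2.1.smul b), fun η hη => ?_⟩
  have aux : ∀ {p q ψ : Rd d → ℝ}, LocallyIntegrableOn p Ω → LocallyIntegrableOn q Ω →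
      IsTest Ω ψ → ∫ x in Ω, (a * p x + b * q x) * ψ x =
        a * (∫ x in Ω, p x * ψ x) + b * ∫ x in Ω, q x * ψ x := by
    intro p q ψ hp hq hψ
    rw [← integral_const_mul, ← integral_const_mul, ← integral_add
      ((hψ.integrableOn_mul hp).const_mul a)
      ((hψ.integrableOn_mul hq).const_mul b)]
    congr 1
    ext x
    ring
  rw [aux h.1 h'.1 (hη.mpd α), aux h.2.1 h'.2.1 hη, h.2.2 η hη, h'.2.2 η hη]
  ring

lemma MemH.isWeakDeriv {n : ℕ} (h : MemH Ω n f) (hα : ∑ i, α i ≤ n) :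
    IsWeakDeriv Ω α f (weakDeriv Ω α f) :=
  isWeakDeriv_weakDeriv (let ⟨f', hf', _⟩ := h.2 α hα; ⟨f', hf'⟩)

lemma MemH.memLp_weakDeriv {n : ℕ} (hΩ : IsOpen Ω) (h : MemH Ω n f) (hα : ∑ i, α i ≤ n) :
    MemLp (weakDeriv Ω α f) 2 (volume.restrict Ω) := by
  obtain ⟨f', hf', hm⟩ := h.2 α hα
  exact (memLp_congr_ae (hf'.weakDeriv_ae_eq hΩ)).2 hm

lemma MemH.linComb {n : ℕ} (h : MemH Ω n f) (h' : MemH Ω n g) (a b : ℝ) :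
    MemH Ω n (fun x => a * f x + b * g x) := by
  refine ⟨(h.1.const_mul a).add (h'.1.const_mul b), fun α hα => ?_⟩
  obtain ⟨f', hf', hm⟩ := h.2 α hα
  obtain ⟨g', hg', hm'⟩ := h'.2 α hα
  exact ⟨_, hf'.linComb hg' a b, (hm.const_mul a).add (hm'.const_mul b)⟩

variable {ρ : Rd d → ℝ}

lemma pd_closure_eq_pd_univ (hΩ : IsOpen Ω) (i : Fin d) {x : Rd d} (hx : x ∈ Ω) :
    MFG.pd (closure Ω) i η x = MFG.pd univ i η x := by
  rw [MFG.pd_closure_eq hΩ hx, pd_univ_apply]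

/-- Each integration by parts strips the outermost derivative off `η`, so the derivatives reach `f`
in reversed order. -/
lemma IsDefiningFunction.integral_mul_pdl_of_isTest (h : IsDefiningFunction Ω ρ)
    (hb : Bornology.IsBounded Ω) (hη : IsTest Ω η) (L : List (Fin d)) :
    ∀ {f : Rd d → ℝ}, ContDiffOn ℝ ∞ f (closure Ω) →
      ∫ x in Ω, f x * pdl univ L η x =
        (-1) ^ L.length * ∫ x in Ω, pdl (closure Ω) L.reverse f x * η x := by
  have hS := h.isRegularSet_closure
  induction L with
  | nil => intro f _; simp
  | cons i L ih =>
    intro f hf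
    have hψ := hη.pdl L
    have h1 : ∀ x ∈ Ω, f x * pdl univ (i :: L) η x = f x * pd (closure Ω) i (pdl univ L η) x :=
      fun x hx => by rw [pd_closure_eq_pd_univ h.isOpen i hx, pdl_cons]
    rw [setIntegral_congr_fun h.isOpen.measurableSet h1,
      h.integral_mul_pd hb (hf.of_le (by exact_mod_cast le_top))
        (hψ.1.contDiffOn.of_le (by exact_mod_cast le_top)) (fun x hx => hψ.eq_zero_of_notMem (by
          rw [h.isOpen.frontier_eq] at hx; exact hx.2)), ih (contDiffOn_infty_pd hS hf),
      List.length_cons, List.reverse_cons, pdl_append, pow_succ]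
    simp

lemma IsDefiningFunction.isWeakDeriv_of_contDiffOn (h : IsDefiningFunction Ω ρ)
    (hb : Bornology.IsBounded Ω) (hf : ContDiffOn ℝ ∞ f (closure Ω)) (α : Fin d → ℕ) :
    IsWeakDeriv Ω α f (mpd (closure Ω) α f) := by
  have hS := h.isRegularSet_closure
  refine ⟨(integrableOn_of_continuousOn_closure hb hf.continuousOn).locallyIntegrableOn,
    (integrableOn_of_continuousOn_closure hb
      (contDiffOn_infty_mpd hS hf α).continuousOn).locallyIntegrableOn, fun η hη => ?_⟩
  rw [mpd_eq_pdl, mpd_eq_pdl, h.integral_mul_pdl_of_isTest hb hη _ hf, length_wordOf]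
  congr 1
  refine setIntegral_congr_fun h.isOpen.measurableSet fun x hx => ?_
  rw [pdl_perm hS (List.reverse_perm _) (hf.of_le (by exact_mod_cast le_top)) (subset_closure hx)]

lemma memLp_two_of_continuousOn_closure (hb : Bornology.IsBounded Ω)
    (hf : ContinuousOn f (closure Ω)) : MemLp f 2 (volume.restrict Ω) := by
  have h1 : AEStronglyMeasurable f (volume.restrict Ω) :=
    (integrableOn_of_continuousOn_closure hb hf).aestronglyMeasurable
  rw [memLp_two_iff_integrable_sq h1]
  exact integrableOn_of_continuousOn_closure hb (hf.pow 2)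

lemma IsDefiningFunction.memH_of_contDiffOn (h : IsDefiningFunction Ω ρ)
    (hb : Bornology.IsBounded Ω) (hf : ContDiffOn ℝ ∞ f (closure Ω)) (n : ℕ) : MemH Ω n f :=
  ⟨memLp_two_of_continuousOn_closure hb hf.continuousOn, fun α _ =>
    ⟨_, h.isWeakDeriv_of_contDiffOn hb hf α, memLp_two_of_continuousOn_closure hb
      (contDiffOn_infty_mpd h.isRegularSet_closure hf α).continuousOn⟩⟩

end Weak

/-! ### A Sobolev bound for Schwartz functions and test functions -/

section Sobolev

open scoped SchwartzMap LineDeriv FourierTransform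

variable {d : ℕ}

/-- The iterated derivative of a Schwartz function along a list of coordinate directions. -/
noncomputable def schwartzDeriv (L : List (Fin d)) (f : 𝓢(Rd d, ℂ)) : 𝓢(Rd d, ℂ) :=
  L.foldr (fun i F => ∂_{(EuclideanSpace.single i (1 : ℝ) : Rd d)} F) f

lemma schwartzDeriv_append (L M : List (Fin d)) (f : 𝓢(Rd d, ℂ)) :
    schwartzDeriv (L ++ M) f = schwartzDeriv L (schwartzDeriv M f) := by
  simp [schwartzDeriv, List.foldr_append]

lemma schwartzDeriv_sub_smul_sum (L : List (Fin d)) (f : 𝓢(Rd d, ℂ)) (c : ℝ)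
    (F : Fin d → 𝓢(Rd d, ℂ)) : schwartzDeriv L (f - c • ∑ i, F i) =
      schwartzDeriv L f - c • ∑ i, schwartzDeriv L (F i) := by
  induction L with
  | nil => rfl
  | cons i L ih =>
    change ∂_{_} (schwartzDeriv L _) = ∂_{_} (schwartzDeriv L _) - c • ∑ j, ∂_{_} (schwartzDeriv L _)
    rw [ih, sub_eq_add_neg, LineDeriv.lineDerivOp_add, LineDeriv.lineDerivOp_neg,
      LineDeriv.lineDerivOp_smul, LineDeriv.lineDerivOp_sum, ← sub_eq_add_neg]

/-- The operator `1 - Δ / (2π)²`. -/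
noncomputable def besselOp (f : 𝓢(Rd d, ℂ)) : 𝓢(Rd d, ℂ) :=
  f - (1 / (2 * Real.pi) ^ 2 : ℝ) • ∑ i, schwartzDeriv [i, i] f

lemma fourier_lineDerivOp_single (f : 𝓢(Rd d, ℂ)) (i : Fin d) (y : Rd d) :
    𝓕 (∂_{(EuclideanSpace.single i (1 : ℝ) : Rd d)} f) y =
      (2 * Real.pi * Complex.I) * ((y i : ℂ) * 𝓕 f y) := by
  have hg : (inner ℝ · (EuclideanSpace.single i (1 : ℝ) : Rd d)).HasTemperateGrowth := by fun_prop
  rw [SchwartzMap.fourier_lineDerivOp_eq, smul_apply, SchwartzMap.smulLeftCLM_apply_apply hg,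
    EuclideanSpace.inner_single_right]
  simp

lemma fourier_schwartzDeriv_pair (f : 𝓢(Rd d, ℂ)) (i : Fin d) (y : Rd d) :
    𝓕 (schwartzDeriv [i, i] f) y = -((2 * Real.pi) ^ 2 * (y i) ^ 2 : ℝ) * 𝓕 f y := by
  change 𝓕 (∂_{(EuclideanSpace.single i (1 : ℝ) : Rd d)}
    (∂_{(EuclideanSpace.single i (1 : ℝ) : Rd d)} f)) y = _
  rw [fourier_lineDerivOp_single, fourier_lineDerivOp_single]
  push_cast
  linear_combination (4 * (Real.pi : ℂ) ^ 2 * (y i : ℂ) ^ 2 * 𝓕 f y) * Complex.I_sq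

lemma fourier_besselOp (f : 𝓢(Rd d, ℂ)) (y : Rd d) :
    𝓕 (besselOp f) y = ((1 + ‖y‖ ^ 2 : ℝ) : ℂ) * 𝓕 f y := by
  have h1 : 𝓕 (besselOp f) =
      𝓕 f - (1 / (2 * Real.pi) ^ 2 : ℝ) • ∑ i, 𝓕 (schwartzDeriv [i, i] f) := by
    simp only [besselOp, ← SchwartzMap.fourierTransformCLM_apply (𝕜 := ℝ), map_sub, map_smul,
      map_sum]
  rw [h1, EuclideanSpace.norm_sq_eq]
  simp only [sub_apply, smul_apply, sum_apply,
    fourier_schwartzDeriv_pair, ← Finset.sum_mul, Real.norm_eq_abs, sq_abs, Complex.real_smul]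
  have hpi : (2 * (Real.pi : ℂ)) ^ 2 ≠ 0 := by
    simp [Real.pi_ne_zero]
  push_cast
  rw [Finset.sum_neg_distrib, ← Finset.mul_sum]
  field_simp
  ring

lemma fourier_besselOp_iterate (n : ℕ) (f : 𝓢(Rd d, ℂ)) (y : Rd d) :
    𝓕 (besselOp^[n] f) y = ((1 + ‖y‖ ^ 2 : ℝ) : ℂ) ^ n * 𝓕 f y := by
  induction n with
  | zero => simp
  | succ n ih => rw [Function.iterate_succ_apply', fourier_besselOp, ih, pow_succ]; ring

lemma norm_sub_smul_sum_le {E : Type*} [NormedAddCommGroup E] [NormedSpace ℝ E] {a : E}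
    {b : Fin d → E} {c M : ℝ} (hc : 0 ≤ c) (ha : ‖a‖ ≤ M) (hb : ∀ i, ‖b i‖ ≤ M) :
    ‖a - c • ∑ i, b i‖ ≤ (1 + c * d) * M := by
  have h1 : ‖∑ i, b i‖ ≤ d * M := (norm_sum_le_of_le _ fun i _ => hb i).trans (by simp)
  have h2 : ‖c • ∑ i, b i‖ ≤ c * (d * M) := by
    rw [norm_smul, Real.norm_of_nonneg hc]
    gcongr
  calc ‖a - c • ∑ i, b i‖ ≤ ‖a‖ + ‖c • ∑ i, b i‖ := norm_sub_le _ _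
    _ ≤ M + c * (d * M) := add_le_add ha h2
    _ = (1 + c * d) * M := by ring

/-- One application of `besselOp` uses two derivatives and costs a factor `1 + d / (2π)²` in the
`L²` bound. -/
lemma norm_toLp_besselOp_iterate_le (n : ℕ) : ∀ (f : 𝓢(Rd d, ℂ)) {M : ℝ},
    (∀ L : List (Fin d), L.length ≤ 2 * n → ‖(schwartzDeriv L f).toLp 2‖ ≤ M) →
    ‖(besselOp^[n] f).toLp 2‖ ≤ (1 + 1 / (2 * Real.pi) ^ 2 * d) ^ n * M := by
  induction n with
  | zero => intro f M h; simpa [schwartzDeriv] using h [] (by simp)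
  | succ n ih =>
    intro f M h
    rw [Function.iterate_succ_apply, pow_succ, mul_assoc]
    refine ih (besselOp f) fun L hL => ?_
    rw [besselOp, schwartzDeriv_sub_smul_sum]
    simp only [← schwartzDeriv_append]
    have h1 : (schwartzDeriv L f - (1 / (2 * Real.pi) ^ 2 : ℝ) •
        ∑ i, schwartzDeriv (L ++ [i, i]) f).toLp 2 volume = (schwartzDeriv L f).toLp 2 volume
        - (1 / (2 * Real.pi) ^ 2 : ℝ) • ∑ i, (schwartzDeriv (L ++ [i, i]) f).toLp 2 volume := by
      simp only [← SchwartzMap.toLpCLM_apply (𝕜 := ℝ), map_sub, map_smul, map_sum]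
    rw [h1]
    exact norm_sub_smul_sum_le (by positivity) (h L (by omega))
      fun i => h (L ++ [i, i]) (by simp; omega)

lemma norm_sq_toLp (f : 𝓢(Rd d, ℂ)) : ‖f.toLp 2‖ ^ 2 = ∫ x, ‖f x‖ ^ 2 := by
  rw [SchwartzMap.norm_toLp' (by norm_num) (by norm_num), ← Real.rpow_natCast, ← Real.rpow_mul
    (integral_nonneg fun x => by positivity)]
  simp

lemma norm_le_integral_fourier (f : 𝓢(Rd d, ℂ)) (x : Rd d) : ‖f x‖ ≤ ∫ y, ‖𝓕 f y‖ := by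
  have h1 : f x = 𝓕 (𝓕 f) (-x) := by
    have h2 : 𝓕⁻ (𝓕 f) = f := FourierTransform.fourierInv_fourier_eq f
    rw [SchwartzMap.fourierInv_apply_eq] at h2
    conv_lhs => rw [← h2]
    simp
  rw [h1, ← SchwartzMap.norm_toLp_one]
  exact SchwartzMap.norm_fourier_apply_le_toLp_one _ _

/-- Fourier inversion bounds `|f|` by `∫ |𝓕 f|`, and `𝓕 f` is the product of `w = (1 + |y|²)^{-n}`
with the transform of `besselOp^[n] f`. The first factor is in `L²` exactly because `d < 4n`, the
second by Plancherel. -/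
theorem exists_schwartz_sobolev_bound (n : ℕ) (hn : (d : ℝ) < 4 * n) :
    ∃ K, 0 ≤ K ∧ ∀ (f : 𝓢(Rd d, ℂ)) (M : ℝ), 0 < M →
      (∀ L : List (Fin d), L.length ≤ 2 * n → ‖(schwartzDeriv L f).toLp 2‖ ≤ M) →
      ∀ x, ‖f x‖ ≤ K * M := by
  set A := (1 + 1 / (2 * Real.pi) ^ 2 * d) ^ n with hA
  have hA0 : 0 ≤ A := by positivity
  set w : Rd d → ℝ := fun y => ((1 + ‖y‖ ^ 2) ^ n)⁻¹ with hw
  have hw2 : Integrable (fun y => w y ^ 2) := by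
    have h1 : Integrable (fun y : Rd d => (1 + ‖y‖ ^ 2) ^ (-(4 * n : ℝ) / 2)) :=
      integrable_rpow_neg_one_add_norm_sq (by simpa using hn)
    refine h1.congr (Eventually.of_forall fun y => ?_)
    have h2 : (-(4 * n : ℝ) / 2) = -((2 * n : ℕ) : ℝ) := by push_cast; ring
    simp only [hw]
    rw [h2, Real.rpow_neg (by positivity), Real.rpow_natCast, inv_pow, ← pow_mul, mul_comm]
  have hW0 : 0 ≤ ∫ y, w y ^ 2 := integral_nonneg fun y => by positivity
  refine ⟨((∫ y, w y ^ 2) + A ^ 2) / 2, by positivity, fun f M hM h x => ?_⟩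
  have hT := norm_toLp_besselOp_iterate_le n f h
  set G := 𝓕 (besselOp^[n] f) with hG
  have hG2 : Integrable (fun y => ‖G y‖ ^ 2) := (G.memLp 2).integrable_norm_pow (by norm_num)
  have hGint : ∫ y, ‖G y‖ ^ 2 ≤ (A * M) ^ 2 := by
    rw [hG, SchwartzMap.integral_norm_sq_fourier, ← norm_sq_toLp]
    gcongr
  -- The weights in `ab ≤ (M/2) a² + b²/(2M)` make both integrals linear in `M`.
  have hpt : ∀ y, ‖𝓕 f y‖ ≤ M / 2 * w y ^ 2 + 1 / (2 * M) * ‖G y‖ ^ 2 := by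
    intro y
    have h1 : ‖𝓕 f y‖ = w y * ‖G y‖ := by
      rw [hG, fourier_besselOp_iterate, norm_mul, norm_pow, Complex.norm_real,
        Real.norm_of_nonneg (by positivity), ← mul_assoc, inv_mul_cancel₀ (by positivity), one_mul]
    rw [h1]
    have h2 : M / 2 * w y ^ 2 + 1 / (2 * M) * ‖G y‖ ^ 2 - w y * ‖G y‖ =
        1 / (2 * M) * (M * w y - ‖G y‖) ^ 2 := by
      field_simp; ring
    have h3 : 0 ≤ 1 / (2 * M) * (M * w y - ‖G y‖) ^ 2 := by positivity
    linarith
  calc ‖f x‖ ≤ ∫ y, ‖𝓕 f y‖ := norm_le_integral_fourier f x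
    _ ≤ ∫ y, (M / 2 * w y ^ 2 + 1 / (2 * M) * ‖G y‖ ^ 2) :=
      integral_mono ((𝓕 f).integrable.norm) ((hw2.const_mul _).add (hG2.const_mul _)) hpt
    _ = M / 2 * (∫ y, w y ^ 2) + 1 / (2 * M) * ∫ y, ‖G y‖ ^ 2 := by
      rw [integral_add (hw2.const_mul _) (hG2.const_mul _), integral_const_mul, integral_const_mul]
    _ ≤ M / 2 * (∫ y, w y ^ 2) + 1 / (2 * M) * (A * M) ^ 2 := by gcongr
    _ = ((∫ y, w y ^ 2) + A ^ 2) / 2 * M := by field_simp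

/-- The Sobolev embedding for the first derivatives of test functions. -/
theorem exists_sobolev_bound_of_isTest {k : ℕ} (hk : (d : ℝ) / 2 + 2 < 2 * (k : ℝ)) :
    ∃ K, 0 ≤ K ∧ ∀ (Ω : Set (Rd d)) (η : Rd d → ℝ), IsTest Ω η → ∀ M : ℝ, 0 < M →
      (∀ α : Fin d → ℕ, ∑ i, α i ≤ 2 * k → (eLpNorm (mpd univ α η) 2 volume).toReal ≤ M) →
      ∀ i x, |pd univ i η x| ≤ K * M := by
  have hk1 : 1 ≤ k := by
    have : (0 : ℝ) < k := by
      have : (0 : ℝ) ≤ d := d.cast_nonneg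
      linarith
    exact_mod_cast this
  -- The bound is applied to `∂ᵢ η`, which leaves `2(k - 1)` further derivatives; `d < 4(k - 1)` is
  -- the hypothesis on `k`.
  obtain ⟨K, hK, h⟩ := exists_schwartz_sobolev_bound (d := d) (k - 1) (by
    rw [Nat.cast_sub hk1]; push_cast; linarith)
  refine ⟨K, hK, fun Ω η hη M hM hb i x => ?_⟩
  have hsupp : HasCompactSupport (fun x => (η x : ℂ)) := hη.2.1.comp_left Complex.ofReal_zero
  have hsm : ContDiff ℝ ∞ (fun x => (η x : ℂ)) := Complex.ofRealCLM.contDiff.comp hη.1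
  set ψ : 𝓢(Rd d, ℂ) := hsupp.toSchwartzMap hsm with hψ
  have hder : ∀ (L : List (Fin d)) (x : Rd d), schwartzDeriv L ψ x = (pdl univ L η x : ℂ) := by
    intro L
    induction L with
    | nil => intro x; rfl
    | cons j L ih =>
      intro x
      change (∂_{(EuclideanSpace.single j (1 : ℝ) : Rd d)} (schwartzDeriv L ψ)) x = _
      rw [SchwartzMap.lineDerivOp_apply_eq_fderiv]
      have h1 : (schwartzDeriv L ψ : Rd d → ℂ) = fun y => Complex.ofRealCLM (pdl univ L η y) :=
        funext ih
      have h2 : DifferentiableAt ℝ (pdl univ L η) x :=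
        (hη.pdl L).1.differentiable (by simp) x
      have h3 : fderiv ℝ (fun y => Complex.ofRealCLM (pdl univ L η y)) x = _ :=
        (Complex.ofRealCLM.hasFDerivAt.comp x h2.hasFDerivAt).fderiv
      rw [h1, pdl_cons, pd_univ_apply, h3]
      simp
  have h1 := h (schwartzDeriv [i] ψ) M hM (fun L hL => by
    rw [← schwartzDeriv_append, SchwartzMap.norm_toLp]
    have h2 : eLpNorm (schwartzDeriv (L ++ [i]) ψ) 2 volume =
        eLpNorm (mpd univ (fun j => (L ++ [i]).count j) η) 2 volume := by
      refine eLpNorm_congr_norm_ae (Eventually.of_forall fun y => ?_)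
      rw [hder, hη.pdl_eqOn_mpd, Complex.norm_real]
    rw [h2]
    exact hb _ (by rw [sum_count]; simp; omega)) x
  rw [hder] at h1
  simpa using h1

end Sobolev

/-! ### Passage from test functions to `H_0^{2k}` -/

section SobolevClosure

variable {d : ℕ} {Ω : Set (Rd d)}

lemma tendsto_integral_mul_of_eLpNorm {μ : Measure (Rd d)} {G f : Rd d → ℝ} {F : ℕ → Rd d → ℝ}
    (hG : MemLp G 2 μ) (hf : MemLp f 2 μ) (hF : ∀ n, MemLp (F n) 2 μ)
    (h : Tendsto (fun n => eLpNorm (F n - f) 2 μ) atTop (𝓝 0)) :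
    Tendsto (fun n => ∫ x, G x * F n x ∂μ) atTop (𝓝 (∫ x, G x * f x ∂μ)) := by
  have key : ∀ {e : Rd d → ℝ} (he : MemLp e 2 μ),
      inner ℝ (hG.toLp G) (he.toLp e) = ∫ x, G x * e x ∂μ := by
    intro e he
    rw [L2.inner_def]
    refine integral_congr_ae ?_
    filter_upwards [hG.coeFn_toLp, he.coeFn_toLp] with x h1 h2
    rw [h1, h2]
    simp [mul_comm]
  have h1 := (Lp.tendsto_Lp_iff_tendsto_eLpNorm'' F hF f hf).2 h
  have h2 := (tendsto_const_nhds (x := hG.toLp G)).inner (𝕜 := ℝ) h1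
  simpa only [key] using h2

lemma MemH0.exists_seq {n : ℕ} {v : Rd d → ℝ} (h : MemH0 Ω n v) :
    ∃ η : ℕ → Rd d → ℝ, (∀ j, IsTest Ω (η j)) ∧ ∀ j, ∀ α : Fin d → ℕ, ∑ i, α i ≤ n →
      eLpNorm (mpd univ α (η j) - weakDeriv Ω α v) 2 (volume.restrict Ω) ≤ (j + 1 : ℝ≥0∞)⁻¹ := by
  have h1 : ∀ j : ℕ, ∃ η, IsTest Ω η ∧ ∀ α : Fin d → ℕ, ∑ i, α i ≤ n →
      eLpNorm (fun x => weakDeriv Ω α v x - mpd univ α η x) 2 (volume.restrict Ω)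
        < (j + 1 : ℝ≥0∞)⁻¹ := fun j => h.2 _ (by
    rw [ENNReal.inv_pos]
    exact_mod_cast ENNReal.natCast_ne_top (j + 1))
  choose η hη hη' using h1
  refine ⟨η, hη, fun j α hα => ?_⟩
  rw [eLpNorm_sub_comm]
  exact (hη' j α hα).le

lemma tendsto_inv_natCast_add_one : Tendsto (fun j : ℕ => (j + 1 : ℝ≥0∞)⁻¹) atTop (𝓝 0) := by
  have := (tendsto_add_atTop_iff_nat 1).2 ENNReal.tendsto_inv_nat_nhds_zero
  simpa using this

/-- For test functions this is the definition of the weak divergence; both sides are continuous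
along the approximating sequence since `F` and `D` are in `L²`. -/
lemma MemH0.integral_mul_weakDiv {n : ℕ} (hΩ : IsOpen Ω) (hn : 1 ≤ n)
    {v : Rd d → ℝ} (h : MemH0 Ω n v) {F : Rd d → Rd d} {D : Rd d → ℝ} (hFD : IsWeakDiv Ω F D)
    (hF : ∀ i, MemLp (fun x => F x i) 2 (volume.restrict Ω))
    (hD : MemLp D 2 (volume.restrict Ω)) :
    ∫ x in Ω, ∑ i, F x i * weakDeriv Ω (Pi.single i 1) v x = - ∫ x in Ω, D x * v x := by
  obtain ⟨η, hη, hconv⟩ := h.exists_seq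
  have hlim : ∀ α : Fin d → ℕ, ∑ i, α i ≤ n → Tendsto (fun j => eLpNorm
      (mpd univ α (η j) - weakDeriv Ω α v) 2 (volume.restrict Ω)) atTop (𝓝 0) := fun α hα =>
    tendsto_of_tendsto_of_tendsto_of_le_of_le tendsto_const_nhds tendsto_inv_natCast_add_one
      (fun _ => zero_le) (fun j => hconv j α hα)
  have hsingle : ∀ i : Fin d, ∑ j, (Pi.single i 1 : Fin d → ℕ) j ≤ n := fun i => by
    simpa using hn
  have h1 : ∀ i, Tendsto (fun j => ∫ x in Ω, F x i * pd univ i (η j) x) atTop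
      (𝓝 (∫ x in Ω, F x i * weakDeriv Ω (Pi.single i 1) v x)) := fun i =>
    tendsto_integral_mul_of_eLpNorm (hF i) (h.1.memLp_weakDeriv hΩ (hsingle i))
      (fun j => ((hη j).pd i).memLp _) (by simpa only [mpd_single] using hlim _ (hsingle i))
  have hv0 : weakDeriv Ω 0 v =ᵐ[volume.restrict Ω] v :=
    (isWeakDeriv_zero (h.1.isWeakDeriv (α := 0) (by simp)).1).weakDeriv_ae_eq hΩ
  have h2 : Tendsto (fun j => ∫ x in Ω, D x * η j x) atTop (𝓝 (∫ x in Ω, D x * v x)) := by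
    have h3 := tendsto_integral_mul_of_eLpNorm hD (h.1.memLp_weakDeriv hΩ (α := 0) (by simp))
      (fun j => (hη j).memLp _) (by simpa only [mpd_zero] using hlim 0 (by simp))
    have h4 : ∫ x in Ω, D x * weakDeriv Ω 0 v x = ∫ x in Ω, D x * v x :=
      integral_congr_ae (by filter_upwards [hv0] with x hx; rw [hx])
    rwa [h4] at h3
  have hsum : ∫ x in Ω, ∑ i, F x i * weakDeriv Ω (Pi.single i 1) v x =
      ∑ i, ∫ x in Ω, F x i * weakDeriv Ω (Pi.single i 1) v x :=
    integral_finsetSum _ fun i _ => (hF i).integrable_mul (h.1.memLp_weakDeriv hΩ (hsingle i))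
  rw [hsum]
  refine tendsto_nhds_unique (tendsto_finsetSum _ fun i _ => h1 i) ?_
  refine h2.neg.congr fun j => ?_
  rw [← hFD.2.2 (η j) (hη j), integral_finsetSum]
  exact fun i _ => (hF i).integrable_mul (((hη j).pd i).memLp _)

/-- The approximating test functions are bounded in `H^{2k}`, so their first derivatives are
uniformly bounded; the bound survives along a subsequence converging almost everywhere. -/
lemma MemH0.exists_bound_weakDeriv {k : ℕ} (hk : (d : ℝ) / 2 + 2 < 2 * (k : ℝ)) (hΩ : IsOpen Ω)
    {v : Rd d → ℝ} (h : MemH0 Ω (2 * k) v) :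
    ∃ B, 0 ≤ B ∧ ∀ i, ∀ᵐ x ∂volume.restrict Ω, |weakDeriv Ω (Pi.single i 1) v x| ≤ B := by
  have hk1 : 1 ≤ 2 * k := by
    have h1 : (0 : ℝ) < k := by
      have : (0 : ℝ) ≤ d := d.cast_nonneg
      linarith
    have : 0 < k := by exact_mod_cast h1
    omega
  obtain ⟨η, hη, hconv⟩ := h.exists_seq
  obtain ⟨K, hK, hsob⟩ := exists_sobolev_bound_of_isTest hk
  set N : (Fin d → ℕ) → ℝ := fun α =>
    (eLpNorm (weakDeriv Ω α v) 2 (volume.restrict Ω)).toReal with hN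
  -- The sum dominates the norm of each weak derivative of `v`; the `1` covers the approximation
  -- error `(j + 1)⁻¹ ≤ 1`.
  set M := 1 + ∑ j ∈ Finset.range (2 * k + 1), ∑ α ∈ multiIndices d j, N α with hM
  have hN0 : ∀ α, 0 ≤ N α := fun α => ENNReal.toReal_nonneg
  have hM0 : 0 < M := by
    have : 0 ≤ ∑ j ∈ Finset.range (2 * k + 1), ∑ α ∈ multiIndices d j, N α :=
      Finset.sum_nonneg fun j _ => Finset.sum_nonneg fun α _ => hN0 α
    linarith
  have hNM : ∀ α : Fin d → ℕ, ∑ i, α i ≤ 2 * k → N α + 1 ≤ M := by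
    intro α hα
    have h1 : N α ≤ ∑ β ∈ multiIndices d (∑ i, α i), N β :=
      Finset.single_le_sum (fun β _ => hN0 β) (mem_multiIndices.2 rfl)
    have h2 : ∑ β ∈ multiIndices d (∑ i, α i), N β ≤
        ∑ j ∈ Finset.range (2 * k + 1), ∑ β ∈ multiIndices d j, N β :=
      Finset.single_le_sum (f := fun j => ∑ β ∈ multiIndices d j, N β)
        (fun j _ => Finset.sum_nonneg fun β _ => hN0 β) (Finset.mem_range.2 (by omega))
    linarith
  have hbound : ∀ j, ∀ α : Fin d → ℕ, ∑ i, α i ≤ 2 * k →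
      (eLpNorm (mpd univ α (η j)) 2 volume).toReal ≤ M := by
    intro j α hα
    have hw := h.1.memLp_weakDeriv hΩ hα
    have hsupp : Function.support (mpd univ α (η j)) ⊆ Ω :=
      (subset_tsupport _).trans ((hη j).mpd α).2.2
    rw [← eLpNorm_restrict_eq_of_support_subset hsupp]
    have h1 : eLpNorm (mpd univ α (η j)) 2 (volume.restrict Ω) ≤
        1 + eLpNorm (weakDeriv Ω α v) 2 (volume.restrict Ω) := by
      have h2 := eLpNorm_add_le (((((hη j).mpd α).memLp (volume.restrict Ω)).sub
        hw).aestronglyMeasurable) hw.aestronglyMeasurable (p := 2) (by norm_num)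
      rw [sub_add_cancel] at h2
      refine h2.trans (add_le_add ((hconv j α hα).trans ?_) le_rfl)
      rw [ENNReal.inv_le_one]
      exact le_add_self
    refine le_trans (ENNReal.toReal_mono (by simp [hw.2.ne]) h1) ?_
    rw [ENNReal.toReal_add (by simp) hw.2.ne, ENNReal.toReal_one, add_comm]
    exact hNM α hα
  refine ⟨K * M, by positivity, fun i => ?_⟩
  have hi : ∑ j, (Pi.single i 1 : Fin d → ℕ) j ≤ 2 * k := by simpa using hk1
  have hlim : Tendsto (fun j => eLpNorm
      (pd univ i (η j) - weakDeriv Ω (Pi.single i 1) v) 2 (volume.restrict Ω)) atTop (𝓝 0) := by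
    refine tendsto_of_tendsto_of_tendsto_of_le_of_le tendsto_const_nhds
      tendsto_inv_natCast_add_one (fun _ => zero_le) (fun j => ?_)
    simpa only [mpd_single] using hconv j _ hi
  obtain ⟨ns, _, hae⟩ := (tendstoInMeasure_of_tendsto_eLpNorm (by norm_num)
    (fun j => (((hη j).pd i).memLp _).aestronglyMeasurable)
    (h.1.memLp_weakDeriv hΩ hi).aestronglyMeasurable hlim).exists_seq_tendsto_ae
  filter_upwards [hae] with x hx
  exact le_of_tendsto hx.abs (Eventually.of_forall fun j =>
    hsob Ω (η (ns j)) (hη _) M hM0 (hbound _) i x)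

end SobolevClosure

/-! ### Weak solutions: bounded gradient, energy inequality and estimate -/

lemma norm_le_sum_abs {d : ℕ} (x : Rd d) : ‖x‖ ≤ ∑ i, |x i| := by
  have h : x = ∑ i, x i • EuclideanSpace.single i (1 : ℝ) := by
    ext l
    simp [Pi.single_apply]
  conv_lhs => rw [h]
  refine (norm_sum_le _ _).trans (Finset.sum_le_sum fun i _ => ?_)
  simp [norm_smul]

namespace ProblemData

variable {d : ℕ} (P : ProblemData d)

/-- A continuous function of the position and a bounded vector field is bounded and measurable. -/
lemma memLp_top_comp {E : Type*} [NormedAddCommGroup E] {Ψ : Rd d × Rd d → E}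
    (hΨ : ContinuousOn Ψ (closure P.Ω ×ˢ univ)) {Du : Rd d → Rd d}
    (hDu : AEMeasurable Du (volume.restrict P.Ω)) {R : ℝ}
    (hR : ∀ᵐ x ∂volume.restrict P.Ω, ‖Du x‖ ≤ R) :
    MemLp (fun x => Ψ (x, Du x)) ⊤ (volume.restrict P.Ω) := by
  have hcomp : IsCompact (closure P.Ω ×ˢ Metric.closedBall (0 : Rd d) R) :=
    P.bounded.isCompact_closure.prod (isCompact_closedBall _ _)
  obtain ⟨C, hC⟩ := hcomp.exists_bound_of_continuousOn
    (hΨ.mono (prod_mono le_rfl (subset_univ _)))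
  have hpair : AEMeasurable (fun x => (x, Du x)) (volume.restrict P.Ω) :=
    aemeasurable_id.prodMk hDu
  refine memLp_top_of_bound ?_ C ?_
  · have hT : MeasurableSet (closure P.Ω ×ˢ (univ : Set (Rd d))) :=
      isClosed_closure.measurableSet.prod MeasurableSet.univ
    -- `Ψ` is continuous only on `closure Ω × ℝ^d`. The image measure is concentrated on this closed
    -- set, which gives measurability of `Ψ` with respect to it.
    have hself : (Measure.map (fun x => (x, Du x)) (volume.restrict P.Ω)).restrict
        (closure P.Ω ×ˢ univ) = Measure.map (fun x => (x, Du x)) (volume.restrict P.Ω) := by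
      refine Measure.restrict_eq_self_of_ae_mem ?_
      refine (ae_map_iff (p := fun z => z ∈ closure P.Ω ×ˢ univ) hpair hT).2 ?_
      filter_upwards [ae_restrict_mem P.measurableSet] with x hx
      exact ⟨subset_closure hx, mem_univ _⟩
    have h1 := hΨ.aestronglyMeasurable
      (μ := Measure.map (fun x => (x, Du x)) (volume.restrict P.Ω)) hT
    rw [hself] at h1
    exact h1.comp_aemeasurable hpair
  · filter_upwards [hR, ae_restrict_mem P.measurableSet] with x h1 h2
    exact hC _ ⟨subset_closure h2, by simpa using h1⟩

end ProblemData

lemma integral_neg_sub_add_add_add {X : Type*} [MeasurableSpace X] {μ : Measure X}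
    {a b c e f : X → ℝ} (ha : Integrable a μ) (hb : Integrable b μ) (hc : Integrable c μ)
    (he : Integrable e μ) (hf : Integrable f μ) :
    ∫ x, (-a x - b x + c x + e x + f x) ∂μ =
      -(∫ x, a x ∂μ) - (∫ x, b x ∂μ) + (∫ x, c x ∂μ) + (∫ x, e x ∂μ) + ∫ x, f x ∂μ := by
  have h1 : Integrable (fun x => -a x - b x) μ := ha.neg.sub hb
  have h2 : Integrable (fun x => -a x - b x + c x) μ := h1.add hc
  have h3 : Integrable (fun x => -a x - b x + c x + e x) μ := h2.add he
  rw [integral_add h3 hf, integral_add h2 he, integral_add h1 hc,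
    integral_sub (f := fun x => -a x) ha.neg hb, integral_neg]

namespace ProblemData

variable {d : ℕ} {P : ProblemData d}

lemma memH_of_contDiffOn {f : Rd d → ℝ} (hf : ContDiffOn ℝ ∞ f (closure P.Ω)) (n : ℕ) :
    MemH P.Ω n f := by
  obtain ⟨ρ, hρ⟩ := P.smoothBoundary
  exact hρ.memH_of_contDiffOn P.bounded hf n

lemma weakDeriv_ae_eq_mpd {f : Rd d → ℝ} (hf : ContDiffOn ℝ ∞ f (closure P.Ω))
    (α : Fin d → ℕ) : weakDeriv P.Ω α f =ᵐ[volume.restrict P.Ω] mpd (closure P.Ω) α f := by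
  obtain ⟨ρ, hρ⟩ := P.smoothBoundary
  exact (hρ.isWeakDeriv_of_contDiffOn P.bounded hf α).weakDeriv_ae_eq P.isOpen

lemma gradOf_weakDeriv_ae_eq {f : Rd d → ℝ} (hf : ContDiffOn ℝ ∞ f (closure P.Ω)) :
    gradOf (weakDeriv P.Ω) f =ᵐ[volume.restrict P.Ω] gradOf (mpd (closure P.Ω)) f := by
  filter_upwards [ae_all_iff.2 fun i : Fin d => weakDeriv_ae_eq_mpd hf (Pi.single i 1)] with x hx
  simp only [gradOf, hx]

lemma continuousOn_add_lapPow {f : Rd d → ℝ} (hf : ContDiffOn ℝ ∞ f (closure P.Ω)) (n : ℕ) :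
    ContinuousOn (fun x => f x + lapPow (closure P.Ω) n f x) (closure P.Ω) := by
  have h1 : ∀ l : ℕ, ContDiffOn ℝ l f (closure P.Ω) := fun l => hf.of_le (by exact_mod_cast le_top)
  exact hf.continuousOn.add
    (contDiffOn_lapPow (n := 0) P.isRegularSet_closure _ (h1 _)).continuousOn

namespace IsWeakSolution

variable {k : ℕ} {g : ℝ → ℝ} {ε : ℝ} {m u : Rd d → ℝ}

lemma weakDeriv_sub_ae_eq (h : P.IsWeakSolution k g ε m u) {α : Fin d → ℕ}
    (hα : ∑ i, α i ≤ 2 * k) :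
    weakDeriv P.Ω α (fun x => u x - P.h x) =ᵐ[volume.restrict P.Ω]
      fun x => weakDeriv P.Ω α u x - weakDeriv P.Ω α P.h x := by
  have h1 := (h.u_mem.isWeakDeriv hα).linComb
    ((memH_of_contDiffOn P.h_smooth (2 * k)).isWeakDeriv hα) 1 (-1)
  have h2 : (fun x => 1 * u x + -1 * P.h x) = fun x => u x - P.h x := by
    funext x; ring
  rw [h2] at h1
  filter_upwards [h1.weakDeriv_ae_eq P.isOpen] with x hx
  rw [hx]; ring

/-- Split `Du` into `D(u - h)`, bounded since `u - h ∈ H_0^{2k}`, and the smooth `Dh`. -/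
lemma exists_bound_gradOf (hk : (d : ℝ) / 2 + 2 < 2 * (k : ℝ)) (hk1 : 1 ≤ k)
    (h : P.IsWeakSolution k g ε m u) :
    ∃ R, ∀ᵐ x ∂volume.restrict P.Ω, ‖gradOf (weakDeriv P.Ω) u x‖ ≤ R := by
  obtain ⟨B, -, hB⟩ := h.u_boundary.exists_bound_weakDeriv hk P.isOpen
  obtain ⟨B', -, hB'⟩ := P.exists_data_bound
  have hsub : ∀ i : Fin d, _ := fun i =>
    h.weakDeriv_sub_ae_eq (α := Pi.single i 1) (by simp; omega)
  refine ⟨∑ _i : Fin d, B + B', ?_⟩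
  filter_upwards [ae_all_iff.2 hB, ae_all_iff.2 hsub, gradOf_weakDeriv_ae_eq P.h_smooth,
    ae_restrict_mem P.measurableSet] with x h1 h2 h3 h4
  have h5 : gradOf (weakDeriv P.Ω) u x =
      gradOf (weakDeriv P.Ω) (fun y => u y - P.h y) x + gradOf (weakDeriv P.Ω) P.h x := by
    ext i
    simp [gradOf, h2]
  rw [h5]
  refine (norm_add_le _ _).trans (add_le_add ((norm_le_sum_abs _).trans
    (Finset.sum_le_sum fun i _ => h1 i)) ?_)
  rw [h3]
  exact (hB' x (subset_closure h4)).2.2.2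

lemma aemeasurable_gradOf (hk1 : 1 ≤ k) (h : P.IsWeakSolution k g ε m u) :
    AEMeasurable (gradOf (weakDeriv P.Ω) u) (volume.restrict P.Ω) := by
  have h1 : AEMeasurable (fun x (i : Fin d) => weakDeriv P.Ω (Pi.single i 1) u x)
      (volume.restrict P.Ω) := aemeasurable_pi_lambda _ fun i =>
    (h.u_mem.memLp_weakDeriv P.isOpen (by simp; omega)).aestronglyMeasurable.aemeasurable
  exact (PiLp.continuous_toLp 2 _).measurable.comp_aemeasurable h1

lemma memLp_top_comp_gradOf (hk : (d : ℝ) / 2 + 2 < 2 * (k : ℝ)) (hk1 : 1 ≤ k)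
    (h : P.IsWeakSolution k g ε m u) {E : Type*} [NormedAddCommGroup E] {Ψ : Rd d × Rd d → E}
    (hΨ : ContinuousOn Ψ (closure P.Ω ×ˢ univ)) :
    MemLp (fun x => Ψ (x, gradOf (weakDeriv P.Ω) u x)) ⊤ (volume.restrict P.Ω) := by
  obtain ⟨R, hR⟩ := h.exists_bound_gradOf hk hk1
  exact P.memLp_top_comp hΨ (h.aemeasurable_gradOf hk1) hR

/-- The competitors `w = m + 1` and `w = 2m` make the bracket of the variational inequality
integrable against `1` and `m`. The terms of the bracket other than `g(m)` are in `L²` and can be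
removed. -/
lemma integrable_coupling (hk : (d : ℝ) / 2 + 2 < 2 * (k : ℝ)) (hk1 : 1 ≤ k)
    (h : P.IsWeakSolution k g ε m u) :
    IntegrableOn (fun x => g (m x)) P.Ω ∧ IntegrableOn (fun x => m x * g (m x)) P.Ω := by
  have := P.isFiniteMeasure
  have hH := h.memLp_top_comp_gradOf hk hk1 P.H_smooth.continuousOn
  have hH2 : MemLp _ 2 (volume.restrict P.Ω) := hH.mono_exponent le_top
  have hV2 : MemLp P.V 2 (volume.restrict P.Ω) :=
    memLp_two_of_continuousOn_closure P.bounded P.V_smooth.continuousOn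
  have hrest := (h.u_mem.1.add hH2).add hV2
  have h1 := (h.variational (fun x => 1 * m x + 1 * 1)
    (h.m_mem.linComb (memH_of_contDiffOn contDiffOn_const _) 1 1)
    (by filter_upwards [h.m_nonneg] with x hx; linarith)).1
  have h2 := (h.variational (fun x => 1 * m x + 1 * m x)
    (h.m_mem.linComb h.m_mem 1 1)
    (by filter_upwards [h.m_nonneg] with x hx; linarith)).1
  constructor
  · refine (h1.add (hrest.integrable one_le_two)).congr (Eventually.of_forall fun x => ?_)
    simp only [Pi.add_apply]
    ring
  · refine (h2.add (h.m_mem.1.integrable_mul hrest)).congr (Eventually.of_forall fun x => ?_)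
    simp only [Pi.add_apply, Pi.mul_apply]
    ring

/-- Take `w = φ`, admissible because `φ ≥ 0`, and `v = u - h`. The variational inequality is
one-sided, so only an upper bound by zero results. -/
lemma integral_energyDensity (hk : (d : ℝ) / 2 + 2 < 2 * (k : ℝ)) (hk1 : 1 ≤ k)
    (h : P.IsWeakSolution k g ε m u) :
    IntegrableOn (P.energyDensity g ε (multiIndices d (2 * k)) m u
      (fun x => P.ξ x + lapPow (closure P.Ω) (2 * k) P.ξ x) (gradOf (weakDeriv P.Ω) u)
      (gradOf (weakDeriv P.Ω) P.h) (fun α => weakDeriv P.Ω α m) (fun α => weakDeriv P.Ω α u)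
      (fun α => weakDeriv P.Ω α P.φ) (fun α => weakDeriv P.Ω α P.h)) P.Ω ∧
    ∫ x in P.Ω, P.energyDensity g ε (multiIndices d (2 * k)) m u
      (fun x => P.ξ x + lapPow (closure P.Ω) (2 * k) P.ξ x) (gradOf (weakDeriv P.Ω) u)
      (gradOf (weakDeriv P.Ω) P.h) (fun α => weakDeriv P.Ω α m) (fun α => weakDeriv P.Ω α u)
      (fun α => weakDeriv P.Ω α P.φ) (fun α => weakDeriv P.Ω α P.h) x ≤ 0 := by
  have := P.isFiniteMeasure
  set S := closure P.Ω with hSdef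
  have hlt : ∀ {α : Fin d → ℕ}, α ∈ multiIndices d (2 * k) → ∑ i, α i ≤ 2 * k := fun hα =>
    (mem_multiIndices.1 hα).le
  have hφ := memH_of_contDiffOn P.φ_smooth (2 * k)
  have hv := h.u_boundary
  obtain ⟨hvar, hvar0⟩ := h.variational P.φ hφ
    ((ae_restrict_iff' P.measurableSet).2 (Eventually.of_forall P.φ_nonneg))
  obtain ⟨D, hD, hdiv, htr⟩ := h.transport
  have htr0 := htr _ hv
  have hζ : MemLp (fun x => P.ξ x + lapPow S (2 * k) P.ξ x) 2 (volume.restrict P.Ω) :=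
    memLp_two_of_continuousOn_closure P.bounded (continuousOn_add_lapPow P.ξ_smooth _)
  have hDp : ∀ i, MemLp (fun x => P.DpH x (gradOf (weakDeriv P.Ω) u x) i) ⊤
      (volume.restrict P.Ω) := fun i =>
    h.memLp_top_comp_gradOf hk hk1 (P.contDiffOn_DpH_apply i).continuousOn
  have hF : ∀ i, MemLp (fun x => (m x • P.DpH x (gradOf (weakDeriv P.Ω) u x)) i) 2
      (volume.restrict P.Ω) := fun i => by
    simpa only [PiLp.smul_apply, smul_eq_mul] using (hDp i).mul' h.m_mem.1
  have hsingle : ∀ i : Fin d, ∑ j, (Pi.single i 1 : Fin d → ℕ) j ≤ 2 * k := fun i => by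
    simp; omega
  have hparts := hv.integral_mul_weakDiv P.isOpen (by omega) hdiv hF hD
  -- integrability of the terms of the two relations
  have i2 : IntegrableOn (fun x => ε * m x * (P.φ x - m x)
      + ε * ∑ α ∈ multiIndices d (2 * k), weakDeriv P.Ω α m x *
        (weakDeriv P.Ω α P.φ x - weakDeriv P.Ω α m x)) P.Ω :=
    ((h.m_mem.1.const_mul ε).integrable_mul (hφ.1.sub h.m_mem.1)).add
      ((integrable_finsetSum _ fun α hα => (h.m_mem.memLp_weakDeriv P.isOpen (hlt hα)).integrable_mul
        ((hφ.memLp_weakDeriv P.isOpen (hlt hα)).sub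
          (h.m_mem.memLp_weakDeriv P.isOpen (hlt hα)))).const_mul ε)
  have i3 : IntegrableOn (fun x => (m x - P.φ x) * (u x - P.h x)) P.Ω :=
    (h.m_mem.1.sub hφ.1).integrable_mul hv.1.1
  have i3' : IntegrableOn (fun x => D x * (u x - P.h x)) P.Ω := hD.integrable_mul hv.1.1
  have i4 : IntegrableOn (fun x => ∑ i, (m x • P.DpH x (gradOf (weakDeriv P.Ω) u x)) i *
      weakDeriv P.Ω (Pi.single i 1) (fun y => u y - P.h y) x) P.Ω :=
    integrable_finsetSum _ fun i _ =>
      (hF i).integrable_mul (hv.1.memLp_weakDeriv P.isOpen (hsingle i))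
  have i5 : IntegrableOn (fun x => ε * (u x * (u x - P.h x)
      + ∑ α ∈ multiIndices d (2 * k), weakDeriv P.Ω α u x *
        weakDeriv P.Ω α (fun y => u y - P.h y) x)
      + ε * (P.ξ x + lapPow S (2 * k) P.ξ x) * (u x - P.h x)) P.Ω :=
    (((h.u_mem.1.integrable_mul hv.1.1).add (integrable_finsetSum _ fun α hα =>
      (h.u_mem.memLp_weakDeriv P.isOpen (hlt hα)).integrable_mul
        (hv.1.memLp_weakDeriv P.isOpen (hlt hα)))).const_mul ε).add
      ((hζ.const_mul ε).integrable_mul hv.1.1)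
  have hae : ∀ᵐ x ∂volume.restrict P.Ω, P.energyDensity g ε (multiIndices d (2 * k)) m u
      (fun x => P.ξ x + lapPow S (2 * k) P.ξ x) (gradOf (weakDeriv P.Ω) u)
      (gradOf (weakDeriv P.Ω) P.h) (fun α => weakDeriv P.Ω α m) (fun α => weakDeriv P.Ω α u)
      (fun α => weakDeriv P.Ω α P.φ) (fun α => weakDeriv P.Ω α P.h) x =
      -((-u x - P.H x (gradOf (weakDeriv P.Ω) u x) + g (m x) - P.V x) * (P.φ x - m x))
      - (ε * m x * (P.φ x - m x)
        + ε * ∑ α ∈ multiIndices d (2 * k), weakDeriv P.Ω α m x *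
          (weakDeriv P.Ω α P.φ x - weakDeriv P.Ω α m x))
      + (m x - P.φ x) * (u x - P.h x)
      + (∑ i, (m x • P.DpH x (gradOf (weakDeriv P.Ω) u x)) i *
          weakDeriv P.Ω (Pi.single i 1) (fun y => u y - P.h y) x)
      + (ε * (u x * (u x - P.h x)
        + ∑ α ∈ multiIndices d (2 * k), weakDeriv P.Ω α u x *
          weakDeriv P.Ω α (fun y => u y - P.h y) x)
        + ε * (P.ξ x + lapPow S (2 * k) P.ξ x) * (u x - P.h x)) := by
    filter_upwards [(eventually_all_finset _).2 fun α hα => h.weakDeriv_sub_ae_eq (hlt hα),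
      ae_all_iff.2 fun i : Fin d => h.weakDeriv_sub_ae_eq (hsingle i)] with x h1 h2
    have e1 : ∑ α ∈ multiIndices d (2 * k), weakDeriv P.Ω α u x *
        weakDeriv P.Ω α (fun y => u y - P.h y) x = ∑ α ∈ multiIndices d (2 * k),
        weakDeriv P.Ω α u x * (weakDeriv P.Ω α u x - weakDeriv P.Ω α P.h x) :=
      Finset.sum_congr rfl fun α hα => by rw [h1 α hα]
    have e2 : (∑ i, (m x • P.DpH x (gradOf (weakDeriv P.Ω) u x)) i *
        weakDeriv P.Ω (Pi.single i 1) (fun y => u y - P.h y) x) =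
        m x * inner ℝ (P.DpH x (gradOf (weakDeriv P.Ω) u x)) (gradOf (weakDeriv P.Ω) u x)
        - m x * inner ℝ (P.DpH x (gradOf (weakDeriv P.Ω) u x))
          (gradOf (weakDeriv P.Ω) P.h x) := by
      rw [P.inner_DpH_eq, P.inner_DpH_eq, ← mul_sub, ← Finset.sum_sub_distrib, Finset.mul_sum]
      refine Finset.sum_congr rfl fun i _ => ?_
      rw [h2 i]
      simp only [gradOf, PiLp.smul_apply, smul_eq_mul]
      ring
    rw [e1, e2, energyDensity]
    simp only [mul_sub, Finset.sum_sub_distrib, Finset.sum_add_distrib, pow_two]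
    ring
  refine ⟨((((hvar.neg.sub i2).add i3).add i4).add i5).congr (hae.mono fun x hx => hx.symm), ?_⟩
  rw [(integral_congr_ae hae).trans (integral_neg_sub_add_add_add hvar i2 i3 i4 i5), hparts]
  have e3 : ∫ x in P.Ω, (m x - D x - P.φ x) * (u x - P.h x) =
      (∫ x in P.Ω, (m x - P.φ x) * (u x - P.h x)) - ∫ x in P.Ω, D x * (u x - P.h x) := by
    rw [← integral_sub i3 i3']
    refine integral_congr_ae (Eventually.of_forall fun x => ?_)
    simp only
    ring
  rw [e3] at htr0
  linarith

lemma aprioriEstimate (hk : (d : ℝ) / 2 + 2 < 2 * (k : ℝ)) (hk1 : 1 ≤ k) {γ : ℝ} (hγ : 1 < γ)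
    {Cδ : ℝ → ℝ} (hgC : P.CouplingGrowth g Cδ) (hε : 0 < ε) (hε1 : ε < 1)
    (h : P.IsWeakSolution k g ε m u) {B Q C : ℝ} (hC : P.EnergyBound γ Cδ B Q C)
    (hB : ∀ x ∈ closure P.Ω, ‖gradOf (mpd (closure P.Ω)) P.h x‖ ≤ B)
    (hQ : (∫ x in P.Ω, (P.φ x ^ 2 + P.h x ^ 2 + (P.ξ x + lapPow (closure P.Ω) (2 * k) P.ξ x) ^ 2
      + ∑ α ∈ multiIndices d (2 * k), (weakDeriv P.Ω α P.φ x ^ 2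
        + weakDeriv P.Ω α P.h x ^ 2))) ≤ Q) :
    P.AprioriEstimate γ k g ε C (weakDeriv P.Ω) m u := by
  have := P.isFiniteMeasure
  have hlt : ∀ {α : Fin d → ℕ}, α ∈ multiIndices d (2 * k) → ∑ i, α i ≤ 2 * k := fun hα =>
    (mem_multiIndices.1 hα).le
  have hφ := memH_of_contDiffOn P.φ_smooth (2 * k)
  have hh := memH_of_contDiffOn P.h_smooth (2 * k)
  have hζ : MemLp (fun x => P.ξ x + lapPow (closure P.Ω) (2 * k) P.ξ x) 2
      (volume.restrict P.Ω) :=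
    memLp_two_of_continuousOn_closure P.bounded (continuousOn_add_lapPow P.ξ_smooth _)
  have hDu : MemLp (fun x => ‖gradOf (weakDeriv P.Ω) u x‖ ^ γ) ⊤ (volume.restrict P.Ω) :=
    h.memLp_top_comp_gradOf (Ψ := fun z => ‖z.2‖ ^ γ) hk hk1
      (continuousOn_snd.norm.rpow_const fun x _ => Or.inr (by linarith))
  have hDu2 : MemLp (fun x => ‖gradOf (weakDeriv P.Ω) u x‖ ^ γ) 2 (volume.restrict P.Ω) :=
    hDu.mono_exponent le_top
  have imD : IntegrableOn (fun x => m x * ‖gradOf (weakDeriv P.Ω) u x‖ ^ γ) P.Ω :=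
    h.m_mem.1.integrable_mul hDu2
  have iφD : IntegrableOn (fun x => P.φ x * ‖gradOf (weakDeriv P.Ω) u x‖ ^ γ) P.Ω :=
    hφ.1.integrable_mul hDu2
  have hsq : ∀ {f f' : Rd d → ℝ}, MemH P.Ω (2 * k) f → MemH P.Ω (2 * k) f' →
      IntegrableOn (fun x => ∑ α ∈ multiIndices d (2 * k),
        (weakDeriv P.Ω α f x ^ 2 + weakDeriv P.Ω α f' x ^ 2)) P.Ω := fun hf hf' =>
    integrable_finsetSum _ fun α hα => (hf.memLp_weakDeriv P.isOpen (hlt hα)).integrable_sq.add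
      (hf'.memLp_weakDeriv P.isOpen (hlt hα)).integrable_sq
  have isq : IntegrableOn (fun x => m x ^ 2 + u x ^ 2 + ∑ α ∈ multiIndices d (2 * k),
      (weakDeriv P.Ω α m x ^ 2 + weakDeriv P.Ω α u x ^ 2)) P.Ω :=
    (h.m_mem.1.integrable_sq.add h.u_mem.1.integrable_sq).add (hsq h.m_mem h.u_mem)
  obtain ⟨ig, img⟩ := h.integrable_coupling hk hk1
  obtain ⟨hE, hE0⟩ := h.integral_energyDensity hk hk1
  refine ⟨img, imD, iφD, isq, ?_⟩
  refine hC g hgC ε hε hε1 (multiIndices d (2 * k)) m u _ _ _ _ _ _ _ h.m_nonneg ?_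
    (h.m_mem.1.integrable one_le_two) ig img imD iφD isq
    (((hφ.1.integrable_sq.add hh.1.integrable_sq).add hζ.integrable_sq).add (hsq hφ hh)) hQ hE hE0
  filter_upwards [gradOf_weakDeriv_ae_eq P.h_smooth, ae_restrict_mem P.measurableSet] with x h1 h2
  rw [h1]
  exact hB x (subset_closure h2)

end IsWeakSolution

end ProblemData

end MFG

theorem proposition3p1 (d k : ℕ) (hk : (d : ℝ) / 2 + 2 < 2 * (k : ℝ)) (γ : ℝ) (hγ : 1 < γ)
    (P : MFG.ProblemData d)
    (hcoer : P.Coercive γ) (hlow : P.LowerGrowth γ) (hgrad : P.GradientGrowth γ)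
    (Cδ : ℝ → ℝ) :
    ∃ C : ℝ, 0 < C ∧
      ∀ g : ℝ → ℝ, ContDiffOn ℝ ∞ g (Ici 0) → P.CouplingGrowth g Cδ →
      ∀ ε : ℝ, 0 < ε → ε < 1 →
      ∀ m u : MFG.Rd d → ℝ,
        (P.IsClassicalSolution k g ε m u →
          P.AprioriEstimate γ k g ε C (MFG.mpd (closure P.Ω)) m u) ∧
        (P.IsWeakSolution k g ε m u →
          P.AprioriEstimate γ k g ε C (MFG.weakDeriv P.Ω) m u) := by
  have hk1 : 1 ≤ k := by
    have h1 : (0 : ℝ) < k := by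
      have : (0 : ℝ) ≤ d := d.cast_nonneg
      linarith
    exact_mod_cast h1
  obtain ⟨B, hB0, hB⟩ := P.exists_data_bound
  -- The bound `Q` on the data must cover both versions of the energy: the classical one sums over
  -- words, the weak one over multi-indices. Neither integral involves `g`, `ε` or the solution.
  obtain ⟨C, hC0, hC⟩ := P.exists_energy_bound hγ hcoer hlow hgrad Cδ hB0
    (fun x hx => (hB x (subset_closure hx)).1) (fun x hx => (hB x (subset_closure hx)).2.1)
    (fun x hx => (hB x (subset_closure hx)).2.2.1) (max
      (∫ x in P.Ω, (P.φ x ^ 2 + P.h x ^ 2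
        + (P.ξ x + MFG.lapPow (closure P.Ω) (2 * k) P.ξ x) ^ 2
        + ∑ w : Fin (2 * k) → Fin d, (MFG.pdl (closure P.Ω) (List.ofFn w) P.φ x ^ 2
          + MFG.pdl (closure P.Ω) (List.ofFn w) P.h x ^ 2)))
      (∫ x in P.Ω, (P.φ x ^ 2 + P.h x ^ 2
        + (P.ξ x + MFG.lapPow (closure P.Ω) (2 * k) P.ξ x) ^ 2
        + ∑ α ∈ MFG.multiIndices d (2 * k), (MFG.weakDeriv P.Ω α P.φ x ^ 2
          + MFG.weakDeriv P.Ω α P.h x ^ 2))))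
  have hgrad_h := fun x hx => (hB x hx).2.2.2
  refine ⟨C, hC0, fun g hg hgC ε hε hε1 m u => ⟨fun h => ?_, fun h => ?_⟩⟩
  · exact h.aprioriEstimate hk1 hγ hg hgC hε hε1 hC hgrad_h (le_max_left _ _)
  · exact h.aprioriEstimate hk hk1 hγ hgC hε hε1 hC hgrad_h (le_max_right _ _)
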